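/- Let $1\le d_e\le d$ be fixed integers. For integers $D>d_e$ set $\mathcal X=[-1,1]^D$, $m=D-d_e$, $n=d-d_e+1$, and $$\tau_0=\tau_0(D,d,d_e):=J_{m,n}(\sqrt{d_e}),\qquad J_{m,n}(\Delta):=\frac{1}{2^{\frac n2-1}\Gamma(\frac n2)}\int_0^\infty\Big(\sqrt{\tfrac2\pi}\int_0^{s/\Delta}e^{-x^2/2}\,dx\Big)^{m}s^{n-1}e^{-s^2/2}\,ds .$$ Say that a function $f:\mathbb R^D\to\mathbb R$ varies only along a linear subspace $\mathcal T\subseteq\mathbb R^D$ if $f(x+z)=f(x)$ for all $x\in\mathcal T$ and $z\in\mathcal T^\perp$. The effective dimension of $f$ is the smallest dimension of such a subspace, and a subspace of that dimension along which alone $f$ varies is called an effective subspace of $f$. (a) There are constants $M_1,M_2>0$ and $D_0$, depending only on $d_e$ and $d$, such that for all $D\ge D_0$ $$M_1\,\frac{\log(D-d_e+1)^{\frac{d-1}{2}}}{(D-d_e+1)^{d_e}}\;\le\;\tau_0\;\le\;M_2\,\frac{\log(D-d_e+1)^{\frac{d-1}{2}}}{(D-d_e+1)^{d_e}} ,$$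 that is, $\tau_0=\Theta\big(\log(D-d_e+1)^{(d-1)/2}/(D-d_e+1)^{d_e}\big)$ as $D\to\infty$. (b) Let $D>d_e$, let $f:\mathbb R^D\to\mathbb R$ be continuous with effective dimension $d_e$ and with an effective subspace spanned by $d_e$ of the standard basis vectors of $\mathbb R^D$, and let $A$ be a $D\times d$ random matrix with independent $\mathcal N(0,1)$ entries. Then, with $f^*=\min_{x\in\mathcal X}f(x)$, $$\mathbb P\big[\exists\,y\in\mathbb R^d:\ Ay\in\mathcal X\ \text{and}\ f(Ay)=f^*\big]\;\ge\;\tau_0\;>\;0 .$$ The probability on the left is the success probability, for $p=0$, of the reduced problem $\min_y f(Ay+p)$ subject to $Ay+p\in\mathcal X$. (c) Hence this success probability decays at worst algebraically in $D$: there is a constant $c>0$, depending only on $d_e$ and $d$, such that in the situation of (b) it is at least $c\,D^{-d_e}$ for every $D>d_e$. -/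

import Mathlib

open MeasureTheory ProbabilityTheory Filter Asymptotics
open scoped Matrix

namespace XREGO

/-- The feasible box `[-1,1]^D` in Euclidean space `ℝ^D`. -/
def box (D : ℕ) : Set (EuclideanSpace ℝ (Fin D)) :=
  {x | ∀ i, x i ∈ Set.Icc (-1 : ℝ) 1}

/-- The optimal value `f^*` of `f` over the box (an attained minimum when `f` is continuous). -/
noncomputable def optValue {D : ℕ} (f : EuclideanSpace ℝ (Fin D) → ℝ) : ℝ :=
  sInf (f '' box D)

/-- The point `A y + p` of `ℝ^D`. -/
noncomputable def embed {D d : ℕ} (A : Matrix (Fin D) (Fin d) ℝ)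
    (p : EuclideanSpace ℝ (Fin D)) (y : Fin d → ℝ) : EuclideanSpace ℝ (Fin D) :=
  WithLp.toLp 2 (A *ᵥ y) + p

/-- The reduced problem `min f (A y + p)` subject to `A y + p ∈ [-1,1]^D` is successful:
some feasible `y` attains the optimal value of the full problem. -/
def Successful {D d : ℕ} (f : EuclideanSpace ℝ (Fin D) → ℝ)
    (A : Matrix (Fin D) (Fin d) ℝ) (p : EuclideanSpace ℝ (Fin D)) : Prop :=
  ∃ y : Fin d → ℝ, f (embed A p y) = optValue f ∧ embed A p y ∈ box D

/-- A `D × d` Gaussian random matrix: the entries are independent standard normal variables. -/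
structure IsGaussianMatrix {Ω : Type*} [MeasurableSpace Ω] {D d : ℕ}
    (A : Ω → Matrix (Fin D) (Fin d) ℝ) (P : Measure Ω) : Prop where
  hasLaw : ∀ i j, HasLaw (fun ω => A ω i j) (gaussianReal 0 1) P
  indep : iIndepFun (fun (ij : Fin D × Fin d) ω => A ω ij.1 ij.2) P

/-- `f` varies only along `T`: `f (x + z) = f x` for all `x ∈ T` and `z ∈ Tᗮ`. -/
def VariesOnlyAlong {D : ℕ} (f : EuclideanSpace ℝ (Fin D) → ℝ)
    (T : Submodule ℝ (EuclideanSpace ℝ (Fin D))) : Prop :=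
  ∀ x ∈ T, ∀ z ∈ Tᗮ, f (x + z) = f x

/-- `f` has effective dimension `k`: the least dimension of a subspace along which alone
`f` varies. -/
def HasEffectiveDimension {D : ℕ} (f : EuclideanSpace ℝ (Fin D) → ℝ) (k : ℕ) : Prop :=
  IsLeast {k | ∃ T : Submodule ℝ (EuclideanSpace ℝ (Fin D)),
    Module.finrank ℝ T = k ∧ VariesOnlyAlong f T} k

/-- `T` is an effective subspace of `f`, and the effective dimension of `f` is `k`. -/
structure IsEffectiveSubspace {D : ℕ} (f : EuclideanSpace ℝ (Fin D) → ℝ) (k : ℕ)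
    (T : Submodule ℝ (EuclideanSpace ℝ (Fin D))) : Prop where
  effectiveDimension : HasEffectiveDimension f k
  finrank_eq : Module.finrank ℝ T = k
  variesOnlyAlong : VariesOnlyAlong f T

/-- `T` is aligned with the coordinate axes: it is spanned by some of the standard basis
vectors. -/
def IsCoordinateAligned {D : ℕ} (T : Submodule ℝ (EuclideanSpace ℝ (Fin D))) : Prop :=
  ∃ S : Set (Fin D), T = Submodule.span ℝ ((fun i => EuclideanSpace.single i (1 : ℝ)) '' S)

/-- The integral `J_{m,n}(Δ)` (used for `n ≥ 1` and `Δ > 0`). -/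
noncomputable def J (m n : ℕ) (Δ : ℝ) : ℝ :=
  1 / (2 ^ ((n : ℝ) / 2 - 1) * Real.Gamma ((n : ℝ) / 2)) *
    ∫ s in Set.Ioi (0 : ℝ),
      (√(2 / Real.pi) * ∫ x in (0 : ℝ)..(s / Δ), Real.exp (-x ^ 2 / 2)) ^ m *
        s ^ (n - 1) * Real.exp (-s ^ 2 / 2)

/-- The lower bound `τ₀ = J_{m,n}(√d_e)` with `m = D - d_e` and `n = d - d_e + 1`
(used for `1 ≤ d_e ≤ d` and `d_e < D`). -/
noncomputable def tau (D d de : ℕ) : ℝ :=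
  J (D - de) (d - de + 1) (√(de : ℝ))

end XREGO

/-!
Lower bound of the probability. By the invariance of Gaussian rows under orthogonal changes of
their index (`pi_stdGaussian_map_orthonormalBasis`) the `d_e` equations, which ask the effective
coordinates of `A y` to be those of the projection `x` of a minimiser to the effective subspace,
become one equation `⟨y, a⟩ = ‖x‖` for a single Gaussian row `a` together with `d_e - 1`
homogeneous ones. Fix the rows of the homogeneous equations. Inside their orthogonal complement
sits an isometric copy of `ℝⁿ`, `n = d - d_e + 1`, and the projection `g` of `a` to it is a
standard Gaussian vector (`stdGaussian_map_adjoint`). The vector `y` of length `‖x‖ / ‖g‖` along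
`g` solves all equations, and given `g` the other `m = D - d_e` coordinates of `A y` are
independent normal variables of standard deviation `‖x‖ / ‖g‖`. All of them lie in `[-1, 1]` with
probability `halfNormalCDF (‖g‖ / ‖x‖) ^ m`, and `‖x‖ ≤ √d_e`. Integrating over `g` in polar
coordinates gives `J` (`lintegral_halfNormalCDF_eq_J`). The argument conditions with one
inequality of Fubini's theorem that needs no measurability (`lintegral_section_le_prod`). Only the
passage to the law of the rows needs a measurable event (`measurableSet_reachableSet`).

Asymptotics of `τ₀`. After the substitution `s = √d_e t` the integrand of `J` is
`Φ(t) ^ m * t ^ (n - 1) * exp (-d_e t² / 2)` with `Φ = halfNormalCDF`. By the Mills bounds for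
`1 - Φ`, the variable `u = Φ(t)` turns it into `u ^ m (1 - u) ^ (d_e - 1)` times a power of `t` of
exponent `n + d_e - 2 = d - 1`. The Beta integral is of order `(m + 1) ^ (-d_e)`, and `t` is of
order `√(log (m + 1))` where the integrand is concentrated (`scaledJ_le`, `le_scaledJ`). The
algebraic lower bound of the probability uses the lower estimate for large `D` and the positivity
of `τ₀` for the finitely many other `D`.
-/

namespace XREGO

/-! ### The normal distribution and standard Gaussian vectors -/

/-- The probability that a standard normal variable lies in `[-t, t]`, for `t ≥ 0`, extended
to an odd function of `t`. -/
noncomputable def halfNormalCDF (t : ℝ) : ℝ :=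
  √(2 / Real.pi) * ∫ x in (0 : ℝ)..t, Real.exp (-x ^ 2 / 2)

lemma hasDerivAt_halfNormalCDF (t : ℝ) :
    HasDerivAt halfNormalCDF (√(2 / Real.pi) * Real.exp (-t ^ 2 / 2)) t := by
  have hc : Continuous fun x : ℝ => Real.exp (-x ^ 2 / 2) := by fun_prop
  exact (intervalIntegral.integral_hasDerivAt_right (hc.intervalIntegrable _ _)
    (hc.stronglyMeasurableAtFilter _ _) hc.continuousAt).const_mul _

@[fun_prop]
lemma continuous_halfNormalCDF : Continuous halfNormalCDF :=
  continuous_iff_continuousAt.2 fun t => (hasDerivAt_halfNormalCDF t).continuousAt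

lemma strictMono_halfNormalCDF : StrictMono halfNormalCDF :=
  strictMono_of_hasDerivAt_pos hasDerivAt_halfNormalCDF fun _ => by positivity

lemma halfNormalCDF_zero : halfNormalCDF 0 = 0 := by simp [halfNormalCDF]

lemma halfNormalCDF_nonneg {t : ℝ} (ht : 0 ≤ t) : 0 ≤ halfNormalCDF t :=
  halfNormalCDF_zero ▸ strictMono_halfNormalCDF.monotone ht

lemma gaussianReal_Icc_neg {t : ℝ} (ht : 0 ≤ t) :
    gaussianReal 0 1 (Set.Icc (-t) t) = ENNReal.ofReal (halfNormalCDF t) := by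
  have hs : ∫ x in (-t)..t, Real.exp (-x ^ 2 / 2) =
      2 * ∫ x in (0 : ℝ)..t, Real.exp (-x ^ 2 / 2) := by
    have hc : Continuous fun x : ℝ => Real.exp (-x ^ 2 / 2) := by fun_prop
    have h := intervalIntegral.integral_comp_neg (a := 0) (b := t)
      fun x : ℝ => Real.exp (-x ^ 2 / 2)
    simp only [neg_sq, neg_zero] at h
    rw [← intervalIntegral.integral_add_adjacent_intervals (hc.intervalIntegrable _ 0)
      (hc.intervalIntegrable 0 _), ← h, two_mul]
  rw [gaussianReal_apply_eq_integral _ one_ne_zero, integral_Icc_eq_integral_Ioc,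
    ← intervalIntegral.integral_of_le (by linarith)]
  simp only [gaussianPDFReal, NNReal.coe_one, mul_one, sub_zero,
    intervalIntegral.integral_const_mul]
  rw [hs, halfNormalCDF, ← mul_assoc]
  congr 2
  rw [Real.sqrt_mul (by norm_num), Real.sqrt_div (by norm_num), mul_inv]
  have h2 : √2 * √2 = (2 : ℝ) := Real.mul_self_sqrt (by norm_num)
  field_simp
  nlinarith

lemma halfNormalCDF_le_one (t : ℝ) : halfNormalCDF t ≤ 1 := by
  rcases le_or_gt 0 t with ht | ht
  · have h := gaussianReal_Icc_neg ht ▸ prob_le_one (μ := gaussianReal 0 1) (s := Set.Icc (-t) t)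
    simpa using h
  · have := strictMono_halfNormalCDF ht
    rw [halfNormalCDF_zero] at this
    linarith

section StandardGaussian

variable {E F : Type*} [NormedAddCommGroup E] [InnerProductSpace ℝ E] [FiniteDimensional ℝ E]
  [MeasurableSpace E] [BorelSpace E] [NormedAddCommGroup F] [InnerProductSpace ℝ F]
  [FiniteDimensional ℝ F] [MeasurableSpace F] [BorelSpace F]

/-- The coordinates of a standard Gaussian vector along an orthonormal system form a standard
Gaussian vector. -/
lemma stdGaussian_map_adjoint (V : F →ₗᵢ[ℝ] E) :
    (stdGaussian E).map (V.toContinuousLinearMap.adjoint) = stdGaussian F := by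
  have hm : AEMeasurable V.toContinuousLinearMap.adjoint (stdGaussian E) :=
    (ContinuousLinearMap.continuous _).aemeasurable
  have := Measure.isProbabilityMeasure_map hm
  apply Measure.ext_of_charFun
  ext t
  rw [charFun_apply, integral_map hm (by fun_prop)]
  simp_rw [ContinuousLinearMap.adjoint_inner_left]
  rw [← charFun_apply, charFun_stdGaussian, charFun_stdGaussian]
  simp

lemma stdGaussian_map_inner {u : E} (hu : ‖u‖ = 1) :
    (stdGaussian E).map (fun c => inner ℝ u c) = gaussianReal 0 1 := by
  have h := IsGaussian.map_eq_gaussianReal (μ := stdGaussian E) (innerSL ℝ u)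
  rw [variance_dual_stdGaussian, integral_strongDual_stdGaussian, innerSL_apply_norm, hu] at h
  simpa using h

/-- The probability that independent standard Gaussian vectors all lie in one slab of half-width
`t`. -/
lemma pi_stdGaussian_slab {β : Type*} [Fintype β] {u : E} (hu : ‖u‖ = 1) {t : ℝ} (ht : 0 ≤ t) :
    Measure.pi (fun _ : β => stdGaussian E) {C | ∀ i, |inner ℝ u (C i)| ≤ t} =
      ENNReal.ofReal (halfNormalCDF t ^ Fintype.card β) := by
  have h1 : {C : β → E | ∀ i, |inner ℝ u (C i)| ≤ t} =
      Set.univ.pi fun _ => (fun c => inner ℝ u c) ⁻¹' Set.Icc (-t) t := by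
    ext C
    simp [abs_le]
  rw [h1, Measure.pi_pi]
  simp_rw [← Measure.map_apply (μ := stdGaussian E) (f := fun c => inner ℝ u c) (by fun_prop)
    measurableSet_Icc, stdGaussian_map_inner hu, gaussianReal_Icc_neg ht]
  rw [Finset.prod_const, Finset.card_univ, ENNReal.ofReal_pow (halfNormalCDF_nonneg ht)]

/-- Independent standard Gaussian vectors stay so under an orthogonal change of their index. -/
lemma pi_stdGaussian_map_orthonormalBasis {ι κ : Type*} [Fintype ι] [Fintype κ]
    (b : OrthonormalBasis κ ℝ (EuclideanSpace ℝ ι)) {d : ℕ} :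
    (Measure.pi fun _ : κ => stdGaussian (EuclideanSpace ℝ (Fin d))).map
      (fun c i => ∑ k, b k i • c k) =
    Measure.pi fun _ : ι => stdGaussian (EuclideanSpace ℝ (Fin d)) := by
  have hm : Measurable fun (c : κ → EuclideanSpace ℝ (Fin d)) (i : ι) => ∑ k, b k i • c k := by
    fun_prop
  have hL : Measurable (WithLp.toLp 2 : (ι → EuclideanSpace ℝ (Fin d)) → _) := by fun_prop
  have := Measure.isProbabilityMeasure_map hm.aemeasurable
    (μ := Measure.pi fun _ : κ => stdGaussian (EuclideanSpace ℝ (Fin d)))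
  suffices h : ((Measure.pi fun _ : κ => stdGaussian (EuclideanSpace ℝ (Fin d))).map
      (fun c i => ∑ k, b k i • c k)).map (WithLp.toLp 2) =
      (Measure.pi fun _ : ι => stdGaussian (EuclideanSpace ℝ (Fin d))).map (WithLp.toLp 2) by
    have h2 := congrArg (Measure.map (WithLp.ofLp)) h
    rw [Measure.map_map (by fun_prop) hL, Measure.map_map (by fun_prop) hL] at h2
    simpa [Function.comp_def] using h2
  have := Measure.isProbabilityMeasure_map hL.aemeasurable
    (μ := (Measure.pi fun _ : κ => stdGaussian (EuclideanSpace ℝ (Fin d))).map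
      (fun c i => ∑ k, b k i • c k))
  have := Measure.isProbabilityMeasure_map hL.aemeasurable
    (μ := (Measure.pi fun _ : ι => stdGaussian (EuclideanSpace ℝ (Fin d))))
  apply Measure.ext_of_charFun
  ext t
  rw [charFun_pi, charFun_apply, integral_map hL.aemeasurable (by fun_prop),
    integral_map hm.aemeasurable (by fun_prop)]
  let s : PiLp 2 (fun _ : κ => EuclideanSpace ℝ (Fin d)) :=
    WithLp.toLp 2 fun k => ∑ i, b k i • t i
  have hinner : ∀ c : κ → EuclideanSpace ℝ (Fin d),
      inner ℝ (WithLp.toLp 2 (fun i => ∑ k, b k i • c k)) t = inner ℝ (WithLp.toLp 2 c) s := by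
    intro c
    simp only [PiLp.inner_apply (𝕜 := ℝ) (f := fun _ : ι => EuclideanSpace ℝ (Fin d)),
      PiLp.inner_apply (𝕜 := ℝ) (f := fun _ : κ => EuclideanSpace ℝ (Fin d)),
      s, sum_inner, inner_sum, real_inner_smul_left, real_inner_smul_right]
    exact Finset.sum_comm
  simp_rw [hinner]
  rw [← integral_map (φ := WithLp.toLp 2) (μ := Measure.pi fun _ : κ =>
      stdGaussian (EuclideanSpace ℝ (Fin d))) (by fun_prop)
      (f := fun x => Complex.exp (((inner ℝ x s : ℝ) : ℂ) * Complex.I)) (by fun_prop),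
    ← charFun_apply, charFun_pi]
  simp_rw [charFun_stdGaussian, ← Complex.exp_sum]
  congr 1
  -- the coordinates of `t` along each column are rotated by `b`, which preserves their norm
  have key : ∑ k, ‖s k‖ ^ 2 = ∑ i, ‖t i‖ ^ 2 := by
    simp_rw [EuclideanSpace.real_norm_sq_eq]
    rw [Finset.sum_comm, Finset.sum_comm (s := (Finset.univ : Finset ι))]
    refine Finset.sum_congr rfl fun j _ => ?_
    have h := b.sum_sq_inner_right (WithLp.toLp 2 fun i => t i j)
    rw [EuclideanSpace.real_norm_sq_eq] at h
    rw [← h]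
    refine Finset.sum_congr rfl fun k _ => ?_
    simp [s, PiLp.inner_apply, mul_comm]
  rw [← Finset.sum_div, ← Finset.sum_div, Finset.sum_neg_distrib, Finset.sum_neg_distrib]
  exact_mod_cast congrArg (fun x : ℝ => -(x : ℂ) / 2) key

/-- The density of the standard Gaussian measure with respect to Lebesgue measure. -/
lemma stdGaussian_eq_withDensity :
    stdGaussian E = volume.withDensity fun x => ENNReal.ofReal
      ((2 * Real.pi) ^ (-(Module.finrank ℝ E : ℝ) / 2) * Real.exp (-‖x‖ ^ 2 / 2)) := by
  set K : ℝ := (2 * Real.pi) ^ (-(Module.finrank ℝ E : ℝ) / 2) with hK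
  have hK0 : 0 ≤ K := by positivity
  have hchar : ∀ t : E, ∫ x : E, (K * Real.exp (-‖x‖ ^ 2 / 2)) •
      Complex.exp ((inner ℝ x t : ℝ) * Complex.I) = Complex.exp (-‖t‖ ^ 2 / 2) := by
    intro t
    have h := GaussianFourier.integral_cexp_neg_mul_sq_norm_add (V := E) (b := 1 / 2) (by norm_num)
      Complex.I t
    have h1 : ∀ x : E, (K * Real.exp (-‖x‖ ^ 2 / 2)) •
        Complex.exp ((inner ℝ x t : ℝ) * Complex.I) =
        (K : ℂ) * Complex.exp (-(1 / 2) * ‖x‖ ^ 2 + Complex.I * (inner ℝ t x : ℝ)) := by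
      intro x
      rw [Complex.exp_add, real_inner_comm, Complex.real_smul]
      push_cast
      rw [mul_assoc]
      congr 3
      · ring
      · ring
    simp_rw [h1]
    rw [integral_const_mul, h, ← mul_assoc]
    have h2 : (K : ℂ) * ((Real.pi : ℂ) / (1 / 2)) ^ ((Module.finrank ℝ E : ℂ) / 2) = 1 := by
      have : ((Real.pi : ℂ) / (1 / 2)) ^ ((Module.finrank ℝ E : ℂ) / 2) =
          (((2 * Real.pi) ^ ((Module.finrank ℝ E : ℝ) / 2) : ℝ) : ℂ) := by
        rw [Complex.ofReal_cpow (by positivity)]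
        push_cast
        congr 1
        ring
      rw [this, ← Complex.ofReal_mul, hK, ← Real.rpow_add (by positivity)]
      simp [neg_div]
    rw [h2, one_mul, Complex.I_sq]
    congr 1
    ring
  have hmeas : Measurable fun x : E => (K * Real.exp (-‖x‖ ^ 2 / 2)).toNNReal := by fun_prop
  have hint : Integrable (fun x : E => K * Real.exp (-‖x‖ ^ 2 / 2)) := by
    -- a non-integrable density would have junk integral `0`, but the integral is `1`
    by_contra hcon
    have h0 := hchar 0
    have : ¬ Integrable fun x : E => (K * Real.exp (-‖x‖ ^ 2 / 2)) •
        Complex.exp ((inner ℝ x 0 : ℝ) * Complex.I) := by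
      intro hi
      apply hcon
      have := hi.re
      simpa [← Complex.ofReal_exp, ← Complex.ofReal_mul] using this
    rw [integral_undef this] at h0
    exact Complex.exp_ne_zero _ h0.symm
  have : IsFiniteMeasure (volume.withDensity fun x : E => ENNReal.ofReal
      (K * Real.exp (-‖x‖ ^ 2 / 2))) := isFiniteMeasure_withDensity_ofReal hint.2
  apply Measure.ext_of_charFun
  ext t
  rw [charFun_stdGaussian, charFun_apply, ← hchar t]
  refine (Eq.trans (integral_withDensity_eq_integral_smul hmeas
    fun x : E => Complex.exp ((inner ℝ x t : ℝ) * Complex.I)) ?_).symm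
  refine integral_congr_ae (Eventually.of_forall fun x => ?_)
  beta_reduce
  rw [NNReal.smul_def, Real.coe_toNNReal _ (by positivity)]

end StandardGaussian

/-! ### Conditioning and the radial part -/

/-- One half of Fubini's theorem for sets that need not be measurable. -/
lemma lintegral_section_le_prod {α β : Type*} [MeasurableSpace α] [MeasurableSpace β]
    (μ : Measure α) (ν : Measure β) [SFinite ν] (s : Set (α × β)) :
    ∫⁻ a, ν (Prod.mk a ⁻¹' s) ∂μ ≤ μ.prod ν s := by
  rw [← measure_toMeasurable s, Measure.prod_apply (measurableSet_toMeasurable _ _)]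
  exact lintegral_mono fun a => measure_mono (Set.preimage_mono (subset_toMeasurable _ s))

/-- The radial part of a standard Gaussian vector in `ℝⁿ` has the chi distribution with `n`
degrees of freedom. -/
lemma lintegral_norm_stdGaussian {n : ℕ} (hn : 1 ≤ n) {φ : ℝ → ℝ} (hφ : Continuous φ)
    (h0 : ∀ s, 0 ≤ s → 0 ≤ φ s) (h1 : ∀ s, 0 ≤ s → φ s ≤ 1) :
    ∫⁻ g, ENNReal.ofReal (φ ‖g‖) ∂stdGaussian (EuclideanSpace ℝ (Fin n)) =
      ENNReal.ofReal (1 / (2 ^ ((n : ℝ) / 2 - 1) * Real.Gamma ((n : ℝ) / 2)) *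
        ∫ s in Set.Ioi (0 : ℝ), φ s * s ^ (n - 1) * Real.exp (-s ^ 2 / 2)) := by
  have hint : Integrable (fun g : EuclideanSpace ℝ (Fin n) => φ ‖g‖)
      (stdGaussian (EuclideanSpace ℝ (Fin n))) := by
    refine Integrable.of_bound (by fun_prop) 1 (Eventually.of_forall fun g => ?_)
    rw [Real.norm_eq_abs, abs_of_nonneg (h0 _ (norm_nonneg _))]
    exact h1 _ (norm_nonneg _)
  rw [← ofReal_integral_eq_lintegral_ofReal hint
    (Eventually.of_forall fun g => h0 _ (norm_nonneg _))]
  congr 1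
  set K : ℝ := (2 * Real.pi) ^ (-(n : ℝ) / 2) with hK
  have : Nonempty (Fin n) := ⟨⟨0, hn⟩⟩
  have hmeas : Measurable fun x : EuclideanSpace ℝ (Fin n) =>
      (K * Real.exp (-‖x‖ ^ 2 / 2)).toNNReal := by fun_prop
  have h2 : ∫ g, φ ‖g‖ ∂stdGaussian (EuclideanSpace ℝ (Fin n)) =
      ∫ g : EuclideanSpace ℝ (Fin n), (K * Real.exp (-‖g‖ ^ 2 / 2)) * φ ‖g‖ := by
    rw [stdGaussian_eq_withDensity, finrank_euclideanSpace_fin]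
    refine (integral_withDensity_eq_integral_smul hmeas
      fun g : EuclideanSpace ℝ (Fin n) => φ ‖g‖).trans ?_
    refine integral_congr_ae (Eventually.of_forall fun g => ?_)
    beta_reduce
    rw [NNReal.smul_def, Real.coe_toNNReal _ (by positivity), smul_eq_mul]
  rw [h2, integral_fun_norm_addHaar volume fun s => (K * Real.exp (-s ^ 2 / 2)) * φ s,
    finrank_euclideanSpace_fin, measureReal_def, EuclideanSpace.volume_ball]
  have hn0 : (0 : ℝ) < n := by exact_mod_cast hn
  have hG : 0 < Real.Gamma ((n : ℝ) / 2) := Real.Gamma_pos_of_pos (by positivity)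
  rw [Fintype.card_fin, ENNReal.ofReal_one, one_pow, one_mul, Real.Gamma_add_one (by positivity),
    ENNReal.toReal_ofReal (by positivity)]
  have h3 : ∀ s : ℝ, s ^ (n - 1) • (K * Real.exp (-s ^ 2 / 2) * φ s) =
      K * (φ s * s ^ (n - 1) * Real.exp (-s ^ 2 / 2)) := fun s => by
    rw [smul_eq_mul]
    ring
  simp_rw [h3]
  rw [integral_const_mul, nsmul_eq_mul, smul_eq_mul, ← mul_assoc, ← mul_assoc]
  congr 1
  have hpi : √Real.pi ^ n = Real.pi ^ ((n : ℝ) / 2) := by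
    rw [Real.sqrt_eq_rpow, ← Real.rpow_natCast, ← Real.rpow_mul Real.pi_pos.le]
    congr 1
    ring
  rw [hpi, hK, Real.mul_rpow (by norm_num) Real.pi_pos.le, neg_div, Real.rpow_neg (by norm_num),
    Real.rpow_neg Real.pi_pos.le, Real.rpow_sub_one (by norm_num)]
  have : (0 : ℝ) < Real.pi ^ ((n : ℝ) / 2) := by positivity
  have : (0 : ℝ) < 2 ^ ((n : ℝ) / 2) := by positivity
  field_simp

lemma lintegral_halfNormalCDF_eq_J {m n : ℕ} (hn : 1 ≤ n) {Δ : ℝ} (hΔ : 0 < Δ) :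
    ∫⁻ g, ENNReal.ofReal (halfNormalCDF (‖g‖ / Δ) ^ m) ∂stdGaussian (EuclideanSpace ℝ (Fin n)) =
      ENNReal.ofReal (J m n Δ) :=
  lintegral_norm_stdGaussian hn (φ := fun s => halfNormalCDF (s / Δ) ^ m) (by fun_prop)
    (fun _ hs => pow_nonneg (halfNormalCDF_nonneg (by positivity)) m)
    fun _ hs => pow_le_one₀ (halfNormalCDF_nonneg (by positivity)) (halfNormalCDF_le_one _)

/-- There is an isometric copy of `ℝⁿ` in `ℝᵈ` orthogonal to any given `k` vectors, as long as
`k + n ≤ d`. The vectors may be linearly dependent. -/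
lemma exists_linearIsometry_orthogonal {κ : Type*} [Fintype κ] {n d : ℕ}
    (h : Fintype.card κ + n ≤ d) (c : κ → EuclideanSpace ℝ (Fin d)) :
    ∃ V : EuclideanSpace ℝ (Fin n) →ₗᵢ[ℝ] EuclideanSpace ℝ (Fin d),
      ∀ k t, inner ℝ (V t) (c k) = 0 := by
  set K := (Submodule.span ℝ (Set.range c))ᗮ with hK
  have h1 : Module.finrank ℝ (Submodule.span ℝ (Set.range c)) ≤ Fintype.card κ :=
    finrank_range_le_card c
  have h2 := Submodule.finrank_add_finrank_orthogonal (Submodule.span ℝ (Set.range c))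
  rw [finrank_euclideanSpace_fin] at h2
  have h3 : n ≤ Module.finrank ℝ K := by
    rw [hK]
    omega
  let u : Fin n → EuclideanSpace ℝ (Fin d) := fun i => stdOrthonormalBasis ℝ K (Fin.castLE h3 i)
  have hu : Orthonormal ℝ u := ((stdOrthonormalBasis ℝ K).orthonormal.comp _
    (Fin.castLE_injective h3)).comp_linearIsometry K.subtypeₗᵢ
  let b := EuclideanSpace.basisFun (Fin n) ℝ
  let f := b.toBasis.constr ℝ u
  have hf : Orthonormal ℝ (f ∘ b.toBasis) := by
    have : f ∘ b.toBasis = u := by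
      ext1 i
      exact b.toBasis.constr_basis ℝ u i
    rwa [this]
  refine ⟨f.isometryOfOrthonormal (v := b.toBasis) (by simp) hf, ?_⟩
  intro k t
  have hmem : f t ∈ K := by
    rw [Module.Basis.constr_apply_fintype]
    exact Submodule.sum_mem _ fun i _ => Submodule.smul_mem _ _ (Subtype.coe_prop _)
  exact (Submodule.mem_orthogonal' _ _).1 hmem _ (Submodule.subset_span ⟨k, rfl⟩)

/-- Conditionally on the rows `a` and `c`: the vector `y` proportional to the projection of `a` to
the range of `V` solves the equations, and the remaining rows are feasible with the probability of
a slab. -/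
lemma halfNormalCDF_le_pi_stdGaussian {κ β : Type*} [Fintype β] [Nonempty β] {n d : ℕ}
    (V : EuclideanSpace ℝ (Fin n) →ₗᵢ[ℝ] EuclideanSpace ℝ (Fin d))
    (c : κ → EuclideanSpace ℝ (Fin d)) (hV : ∀ k t, inner ℝ (V t) (c k) = 0)
    (a : EuclideanSpace ℝ (Fin d)) {r Δ : ℝ} (hr : 0 < r) (hrΔ : r ≤ Δ) :
    ENNReal.ofReal
      (halfNormalCDF (‖V.toContinuousLinearMap.adjoint a‖ / Δ) ^ Fintype.card β) ≤
    Measure.pi (fun _ : β => stdGaussian (EuclideanSpace ℝ (Fin d)))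
      {C | ∃ y, inner ℝ y a = r ∧ (∀ k, inner ℝ y (c k) = 0) ∧ ∀ i, |inner ℝ y (C i)| ≤ 1} := by
  set g := V.toContinuousLinearMap.adjoint a with hg
  rcases eq_or_ne g 0 with h0 | h0
  -- the left-hand side vanishes, since `β` is nonempty
  · simp [h0, halfNormalCDF_zero]
  have hg0 : 0 < ‖g‖ := norm_pos_iff.2 h0
  set u := V (‖g‖⁻¹ • g) with hu
  have hu1 : ‖u‖ = 1 := by
    rw [hu, V.norm_map, norm_smul, norm_inv, norm_norm, inv_mul_cancel₀ hg0.ne']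
  have hua : inner ℝ u a = ‖g‖ := by
    have : inner ℝ u a = inner ℝ (‖g‖⁻¹ • g) g :=
      (V.toContinuousLinearMap.adjoint_inner_right _ _).symm
    rw [this, real_inner_smul_left, real_inner_self_eq_norm_sq]
    field_simp
  have hpos : 0 ≤ ‖g‖ / r := by positivity
  calc ENNReal.ofReal (halfNormalCDF (‖g‖ / Δ) ^ Fintype.card β)
      ≤ ENNReal.ofReal (halfNormalCDF (‖g‖ / r) ^ Fintype.card β) := by
        have hΔ := hr.trans_le hrΔ
        refine ENNReal.ofReal_le_ofReal
          (pow_le_pow_left₀ (halfNormalCDF_nonneg (by positivity)) ?_ _)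
        exact strictMono_halfNormalCDF.monotone (by gcongr)
    _ = _ := (pi_stdGaussian_slab hu1 hpos).symm
    _ ≤ _ := by
        refine measure_mono fun C hC => ⟨(r / ‖g‖) • u, ?_, fun k => ?_, fun i => ?_⟩
        · rw [real_inner_smul_left, hua]
          field_simp
        · rw [real_inner_smul_left, hV, mul_zero]
        · rw [real_inner_smul_left, abs_mul, abs_of_pos (by positivity), div_mul_eq_mul_div,
            div_le_one hg0, ← le_div_iff₀' hr]
          exact hC i

/-- The distance of a Gaussian row to the span of the rows indexed by `q` dominates a
chi variable, whence the lower bound `J`. -/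
lemma J_le_pi_stdGaussian {ι : Type*} [Fintype ι] [DecidableEq ι] (q : ι → Prop)
    [DecidablePred q] (k₀ : {k // ¬ q k}) {m n d : ℕ} (hm : 1 ≤ m) (hn : 1 ≤ n)
    (hcard : Fintype.card {i : {k // ¬ q k} // ¬ i = k₀} = m)
    (hd : Fintype.card {k // q k} + n ≤ d) {r Δ : ℝ} (hr : 0 < r) (hrΔ : r ≤ Δ) :
    ENNReal.ofReal (J m n Δ) ≤
      Measure.pi (fun _ : ι => stdGaussian (EuclideanSpace ℝ (Fin d)))
        {c | ∃ y, inner ℝ y (c k₀) = r ∧ (∀ k, q k → inner ℝ y (c k) = 0) ∧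
          ∀ i, ¬ q i → i ≠ k₀ → |inner ℝ y (c i)| ≤ 1} := by
  let F := EuclideanSpace ℝ (Fin d)
  have hne : Nonempty {i : {k // ¬ q k} // ¬ i = k₀} :=
    Fintype.card_pos_iff.1 (by omega)
  -- the killed rows are separated from the others
  let G : Set (({k // q k} → F) × ({k // ¬ q k} → F)) :=
    {c | ∃ y, inner ℝ y (c.2 k₀) = r ∧ (∀ k, inner ℝ y (c.1 k) = 0) ∧
      ∀ i, i ≠ k₀ → |inner ℝ y (c.2 i)| ≤ 1}
  have h1 := (measurePreserving_piEquivPiSubtypeProd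
    (fun _ : ι => stdGaussian F) q).measure_preimage_equiv G
  have h2 : (MeasurableEquiv.piEquivPiSubtypeProd (fun _ : ι => F) q) ⁻¹' G =
      {c | ∃ y, inner ℝ y (c k₀) = r ∧ (∀ k, q k → inner ℝ y (c k) = 0) ∧
          ∀ i, ¬ q i → i ≠ k₀ → |inner ℝ y (c i)| ≤ 1} := by
    ext c
    refine exists_congr fun y => and_congr Iff.rfl (and_congr ?_ ?_)
    · exact ⟨fun h k hk => h ⟨k, hk⟩, fun h k => h k k.2⟩
    · exact ⟨fun h i hi hik => h ⟨i, hi⟩ fun e => hik (congrArg Subtype.val e),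
        fun h i hik => h i i.2 fun e => hik (Subtype.ext e)⟩
  rw [← h2, h1]
  refine le_trans ?_ (lintegral_section_le_prod _ _ _)
  refine le_trans (by rw [lintegral_const, measure_univ, mul_one]) (lintegral_mono
    (f := fun _ => ENNReal.ofReal (J m n Δ)) fun c => ?_)
  obtain ⟨V, hV⟩ := exists_linearIsometry_orthogonal hd c
  -- then the row `k₀` is separated from the remaining ones
  let G' : Set (({i : {k // ¬ q k} // i = k₀} → F) × ({i : {k // ¬ q k} // ¬ i = k₀} → F)) :=
    {C | ∃ y, inner ℝ y (C.1 ⟨k₀, rfl⟩) = r ∧ (∀ k, inner ℝ y (c k) = 0) ∧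
      ∀ i, |inner ℝ y (C.2 i)| ≤ 1}
  have h3 := (measurePreserving_piEquivPiSubtypeProd
    (fun _ : {k // ¬ q k} => stdGaussian F) (fun i => i = k₀)).measure_preimage_equiv G'
  have h4 : (MeasurableEquiv.piEquivPiSubtypeProd (fun _ : {k // ¬ q k} => F)
      (fun i => i = k₀)) ⁻¹' G' = Prod.mk c ⁻¹' G := by
    ext C
    refine exists_congr fun y => and_congr Iff.rfl (and_congr Iff.rfl ?_)
    exact ⟨fun h i hi => h ⟨i, hi⟩, fun h i => h i i.2⟩
  rw [← h4, h3]
  refine le_trans ?_ (lintegral_section_le_prod _ _ _)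
  have h5 := fun a => halfNormalCDF_le_pi_stdGaussian (β := {i : {k // ¬ q k} // ¬ i = k₀})
    V c hV a hr hrΔ
  rw [hcard] at h5
  refine le_trans (le_of_eq ?_) (lintegral_mono fun C => h5 (C ⟨k₀, rfl⟩))
  let _ : Fintype {i : {k // ¬ q k} // i = k₀} := Subtype.fintype _
  have h6 := (measurePreserving_eval (fun _ : {i : {k // ¬ q k} // i = k₀} => stdGaussian F)
    ⟨k₀, rfl⟩).lintegral_comp (f := fun a => ENNReal.ofReal
      (halfNormalCDF (‖V.toContinuousLinearMap.adjoint a‖ / Δ) ^ m)) (by fun_prop)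
  refine Eq.trans ?_ h6.symm
  rw [← lintegral_halfNormalCDF_eq_J hn (hr.trans_le hrΔ), ← stdGaussian_map_adjoint V,
    lintegral_map (by fun_prop) (by fun_prop)]

/-! ### The success event -/

/-- The matrices, given by their rows, whose range contains a point that agrees with `x` in the
coordinates `i` with `p i` and lies in `[-1, 1]` in the other coordinates. -/
def reachableSet {D : ℕ} (d : ℕ) (p : Fin D → Prop) (x : Fin D → ℝ) :
    Set (Fin D → EuclideanSpace ℝ (Fin d)) :=
  {A | ∃ y, (∀ i, p i → inner ℝ y (A i) = x i) ∧ ∀ i, ¬ p i → |inner ℝ y (A i)| ≤ 1}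

/-- The set is a countable union of projections of closed sets along closed balls. -/
lemma measurableSet_reachableSet {D d : ℕ} (p : Fin D → Prop) (x : Fin D → ℝ) :
    MeasurableSet (reachableSet d p x) := by
  let Z : Set ((Fin D → EuclideanSpace ℝ (Fin d)) × EuclideanSpace ℝ (Fin d)) :=
    {z | (∀ i, p i → inner ℝ z.2 (z.1 i) = x i) ∧ ∀ i, ¬ p i → |inner ℝ z.2 (z.1 i)| ≤ 1}
  have hZ : IsClosed Z := by
    have hZ' : Z = (⋂ i, ⋂ (_ : p i), {z | inner ℝ z.2 (z.1 i) = x i}) ∩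
        ⋂ i, ⋂ (_ : ¬ p i), {z | |inner ℝ z.2 (z.1 i)| ≤ 1} := by
      ext z
      simp [Z]
    rw [hZ']
    refine (isClosed_iInter fun i => isClosed_iInter fun _ => isClosed_eq ?_ ?_).inter
      (isClosed_iInter fun i => isClosed_iInter fun _ => isClosed_le ?_ ?_) <;> fun_prop
  have h : reachableSet d p x = ⋃ R : ℕ, Prod.fst ''
      ((fun z : (Fin D → EuclideanSpace ℝ (Fin d)) ×
        Metric.closedBall (0 : EuclideanSpace ℝ (Fin d)) R => (z.1, z.2.1)) ⁻¹' Z) := by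
    ext A
    simp only [Set.mem_iUnion, Set.mem_image]
    constructor
    · rintro ⟨y, hy⟩
      obtain ⟨R, hR⟩ := exists_nat_ge ‖y‖
      exact ⟨R, (A, ⟨y, by simpa using hR⟩), hy, rfl⟩
    · rintro ⟨R, ⟨A', y⟩, hy, rfl⟩
      exact ⟨y, hy⟩
  rw [h]
  refine MeasurableSet.iUnion fun R => IsClosed.measurableSet ?_
  have : CompactSpace (Metric.closedBall (0 : EuclideanSpace ℝ (Fin d)) R) :=
    isCompact_iff_compactSpace.1 (isCompact_closedBall _ _)
  exact isClosedMap_fst_of_compactSpace _ (hZ.preimage (by fun_prop))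

lemma tau_le_one {D d de : ℕ} (hde : 1 ≤ de) : ENNReal.ofReal (tau D d de) ≤ 1 := by
  have hΔ : (0 : ℝ) < √de := Real.sqrt_pos.2 (by exact_mod_cast hde)
  rw [tau, ← lintegral_halfNormalCDF_eq_J (by omega) hΔ]
  refine (lintegral_mono (g := fun _ => 1) fun g => ?_).trans (by simp)
  rw [← ENNReal.ofReal_one]
  exact ENNReal.ofReal_le_ofReal
    (pow_le_one₀ (halfNormalCDF_nonneg (by positivity)) (halfNormalCDF_le_one _))

lemma tau_le_pi_reachableSet {D d de : ℕ} (hde : 1 ≤ de) (hd : de ≤ d) (hD : de < D)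
    (p : Fin D → Prop) [DecidablePred p] (hp : Fintype.card {i // p i} = de) (x : Fin D → ℝ)
    (hx : ∀ i, |x i| ≤ 1) :
    ENNReal.ofReal (tau D d de) ≤
      Measure.pi (fun _ : Fin D => stdGaussian (EuclideanSpace ℝ (Fin d)))
        (reachableSet d p x) := by
  let xS : EuclideanSpace ℝ (Fin D) := WithLp.toLp 2 fun i => if p i then x i else 0
  have hxS : ∀ i, xS i = if p i then x i else 0 := fun i => rfl
  rcases eq_or_ne xS 0 with h0 | h0
  · -- the origin is reached by every matrix
    have : reachableSet d p x = Set.univ := by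
      refine Set.eq_univ_of_forall fun A => ⟨0, fun i hi => ?_, fun i _ => by simp⟩
      have := hxS i
      rw [if_pos hi, h0] at this
      simpa using this
    rw [this, measure_univ]
    exact tau_le_one hde
  set r := ‖xS‖ with hr
  have hr0 : 0 < r := norm_pos_iff.2 h0
  have hrΔ : r ≤ √de := by
    refine Real.le_sqrt_of_sq_le ?_
    rw [hr, EuclideanSpace.real_norm_sq_eq, ← hp, Fintype.card_subtype, Finset.card_eq_sum_ones,
      Nat.cast_sum, Finset.sum_filter]
    refine Finset.sum_le_sum fun i _ => ?_
    rw [hxS]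
    split_ifs
    · simpa using (sq_le_one_iff_abs_le_one _).2 (hx i)
    · simp
  obtain ⟨k₀, hk₀⟩ : ∃ k, p k := by
    have : 0 < Fintype.card {i // p i} := by omega
    obtain ⟨k⟩ := Fintype.card_pos_iff.1 this
    exact ⟨k, k.2⟩
  let q : Fin D → Prop := fun k => p k ∧ k ≠ k₀
  have hq : ¬ q k₀ := fun h => h.2 rfl
  have hqp : ∀ i, ¬ q i → i ≠ k₀ → ¬ p i := fun i hi hik hpi => hi ⟨hpi, hik⟩
  have hpq : ∀ i, ¬ p i → ¬ q i := fun i hi h => hi h.1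
  have hcq : Fintype.card {k // q k} = de - 1 := by
    rw [← hp, Fintype.card_subtype, Fintype.card_subtype,
      ← Finset.card_erase_of_mem (a := k₀) (by simpa using hk₀)]
    congr 1
    ext k
    simp [q, and_comm]
  have hcn : Fintype.card {i : {k // ¬ q k} // ¬ i = ⟨k₀, hq⟩} = D - de := by
    rw [Fintype.card_subtype_compl, Fintype.card_subtype_compl, Fintype.card_subtype_eq, hcq,
      Fintype.card_fin]
    omega
  -- an orthonormal basis through `x / ‖x‖` and the remaining coordinate directions
  have hort : Orthonormal ℝ ({i | ¬ q i}.domRestrict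
      fun i => if i = k₀ then r⁻¹ • xS else EuclideanSpace.single i (1 : ℝ)) := by
    refine ⟨?_, ?_⟩
    · rintro ⟨i, hi⟩
      by_cases hik : i = k₀
      · simp [Set.domRestrict, hik, norm_smul, ← hr, abs_of_pos hr0, hr0.ne']
      · simp [Set.domRestrict, hik]
    · rintro ⟨i, hi⟩ ⟨j, hj⟩ hij
      have hij : i ≠ j := fun e => hij (Subtype.ext e)
      by_cases hik : i = k₀
      · have hjk : j ≠ k₀ := fun e => hij (hik.trans e.symm)
        simp [Set.domRestrict, hik, hjk, hxS, EuclideanSpace.inner_single_right, hqp j hj hjk]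
      · by_cases hjk : j = k₀
        · simp [Set.domRestrict, hik, hjk, hxS, EuclideanSpace.inner_single_left, hqp i hi hik]
        · simp [Set.domRestrict, hik, hjk, EuclideanSpace.inner_single_left, hij]
  obtain ⟨b, hb⟩ := hort.exists_orthonormalBasis_extension_of_card_eq (by simp)
  have hb0 : b k₀ = r⁻¹ • xS := by simpa using hb k₀ hq
  have hb1 : ∀ i, ¬ p i → b i = EuclideanSpace.single i (1 : ℝ) := fun i hi => by
    have hik : i ≠ k₀ := fun e => hi (e ▸ hk₀)
    simpa [hik] using hb i (hpq i hi)
  rw [← pi_stdGaussian_map_orthonormalBasis b]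
  refine le_trans ?_ (Measure.le_map_apply (Measurable.aemeasurable (by fun_prop)) _)
  refine (J_le_pi_stdGaussian q ⟨k₀, hq⟩ (by omega) (by omega) hcn (by omega) hr0 hrΔ).trans
    (measure_mono ?_)
  rintro c ⟨y, hy0, hyq, hyp⟩
  refine ⟨y, fun i hi => ?_, fun i hi => ?_⟩
  · rw [inner_sum, Finset.sum_eq_single k₀]
    · rw [real_inner_smul_right, hy0, hb0, PiLp.smul_apply, hxS, if_pos hi, smul_eq_mul]
      field_simp
    · intro k _ hk
      rw [real_inner_smul_right]
      by_cases hqk : q k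
      · rw [hyq k hqk, mul_zero]
      · have hpk := hqp k hqk hk
        have : i ≠ k := fun e => hpk (e ▸ hi)
        simp [hb1 k hpk, this]
    · simp
  · have hik : i ≠ k₀ := fun e => hi (e ▸ hk₀)
    rw [inner_sum, Finset.sum_eq_single i]
    · rw [real_inner_smul_right, hb1 i hi]
      simpa using hyp i (hpq i hi) hik
    · intro k _ hk
      have h : b k i = inner ℝ (b i) (b k) := by
        simp [hb1 i hi, EuclideanSpace.inner_single_left]
      rw [h, b.orthonormal.2 hk.symm]
      simp
    · simp

/-- The rows of a Gaussian matrix are independent standard Gaussian vectors. -/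
lemma IsGaussianMatrix.map_rows {Ω : Type*} [MeasurableSpace Ω] {D d : ℕ}
    {A : Ω → Matrix (Fin D) (Fin d) ℝ} {P : Measure Ω} [IsProbabilityMeasure P]
    (hA : IsGaussianMatrix A P) :
    AEMeasurable (fun ω (i : Fin D) => WithLp.toLp 2 (A ω i)) P ∧
    P.map (fun ω (i : Fin D) => WithLp.toLp 2 (A ω i)) =
      Measure.pi fun _ : Fin D => stdGaussian (EuclideanSpace ℝ (Fin d)) := by
  have hm : ∀ ij : Fin D × Fin d, AEMeasurable (fun ω => A ω ij.1 ij.2) P := fun ij =>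
    (hA.hasLaw ij.1 ij.2).aemeasurable
  have h1 := (iIndepFun_iff_map_fun_eq_pi_map hm).1 hA.indep
  simp_rw [fun ij : Fin D × Fin d => (hA.hasLaw ij.1 ij.2).map_eq] at h1
  have hm1 : AEMeasurable (fun ω (ij : Fin D × Fin d) => A ω ij.1 ij.2) P :=
    aemeasurable_pi_lambda _ hm
  have h2 := Measure.infinitePi_map_curry fun (_ : Fin D) (_ : Fin d) => gaussianReal 0 1
  simp_rw [Measure.infinitePi_eq_pi] at h2
  have h3 := Measure.pi_map_pi (μ := fun _ : Fin D => Measure.pi fun _ : Fin d => gaussianReal 0 1)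
    (f := fun _ => WithLp.toLp 2) (fun _ => by fun_prop)
  simp_rw [map_pi_eq_stdGaussian] at h3
  have hm2 : Measurable fun (a : Fin D → Fin d → ℝ) i => WithLp.toLp 2 (a i) := by fun_prop
  refine ⟨?_, ?_⟩
  · exact (hm2.comp (MeasurableEquiv.curry _ _ _).measurable).comp_aemeasurable hm1
  · rw [← h3, ← h2, ← h1, Measure.map_map hm2 (MeasurableEquiv.measurable _),
      AEMeasurable.map_map_of_aemeasurable
        (hm2.comp (MeasurableEquiv.measurable _)).aemeasurable hm1]
    rfl

lemma IsGaussianMatrix.tau_le_prob_successful {Ω : Type*} [MeasurableSpace Ω] {D d de : ℕ}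
    (hde : 1 ≤ de) (hd : de ≤ d) (hD : de < D)
    {A : Ω → Matrix (Fin D) (Fin d) ℝ} {P : Measure Ω} [IsProbabilityMeasure P]
    (hA : IsGaussianMatrix A P) {f : EuclideanSpace ℝ (Fin D) → ℝ} (hf : Continuous f)
    {T : Submodule ℝ (EuclideanSpace ℝ (Fin D))} (hT : IsEffectiveSubspace f de T)
    (hTc : IsCoordinateAligned T) :
    tau D d de ≤ P.real {ω | Successful f (A ω) 0} := by
  classical
  obtain ⟨S, rfl⟩ := hTc
  -- a minimiser over the box
  have hbox : IsCompact (box D) := by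
    have : box D = (EuclideanSpace.equiv (Fin D) ℝ).toHomeomorph ⁻¹'
        Set.univ.pi fun _ => Set.Icc (-1 : ℝ) 1 := by
      ext x
      exact ⟨fun h i _ => h i, fun h i => h i trivial⟩
    rw [this, Homeomorph.isCompact_preimage]
    exact isCompact_univ_pi fun _ => isCompact_Icc
  obtain ⟨x, hxbox, hxmin⟩ := hbox.exists_isMinOn ⟨0, fun i => by simp⟩ hf.continuousOn
  have hopt : optValue f = f x := by
    refine IsLeast.csInf_eq ⟨⟨x, hxbox, rfl⟩, ?_⟩
    rintro _ ⟨z, hz, rfl⟩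
    exact hxmin hz
  -- `f` depends on the coordinates in `S` only
  have hdep : ∀ z : EuclideanSpace ℝ (Fin D), (∀ i ∈ S, z i = x i) → f z = f x := by
    intro z hz
    let w : EuclideanSpace ℝ (Fin D) := WithLp.toLp 2 fun i => if i ∈ S then x i else 0
    have hw : w ∈ Submodule.span ℝ ((fun i => EuclideanSpace.single i (1 : ℝ)) '' S) := by
      rw [← (EuclideanSpace.basisFun (Fin D) ℝ).sum_repr w]
      refine Submodule.sum_mem _ fun i _ => ?_
      by_cases hi : i ∈ S
      · exact Submodule.smul_mem _ _ (Submodule.subset_span ⟨i, hi, by simp⟩)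
      · simp [w, hi]
    have hperp : ∀ v : EuclideanSpace ℝ (Fin D), (∀ i ∈ S, v i = x i) →
        v - w ∈ (Submodule.span ℝ ((fun i => EuclideanSpace.single i (1 : ℝ)) '' S))ᗮ := by
      intro v hv
      rw [Submodule.mem_orthogonal]
      intro u hu
      induction hu using Submodule.span_induction with
      | mem u hu =>
        obtain ⟨i, hi, rfl⟩ := hu
        simp [w, hi, hv i hi, EuclideanSpace.inner_single_left]
      | zero => simp
      | add a b _ _ ha hb => rw [inner_add_left, ha, hb, add_zero]
      | smul t a _ ha => rw [real_inner_smul_left, ha, mul_zero]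
    have h1 := hT.variesOnlyAlong w hw _ (hperp z hz)
    have h2 := hT.variesOnlyAlong w hw _ (hperp x fun _ _ => rfl)
    rw [add_sub_cancel] at h1 h2
    rw [h1, h2]
  have hcard : Fintype.card {i // i ∈ S} = de := by
    rw [← hT.finrank_eq, Set.image_eq_range]
    refine (finrank_span_eq_card ?_).symm
    have := (EuclideanSpace.basisFun (Fin D) ℝ).orthonormal.linearIndependent.comp
      (Subtype.val : S → Fin D) Subtype.val_injective
    simpa [Function.comp_def] using this
  obtain ⟨hm, hlaw⟩ := hA.map_rows
  have h1 := tau_le_pi_reachableSet hde hd hD (· ∈ S) hcard (fun i => x i)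
    fun i => abs_le.2 (hxbox i)
  rw [← hlaw, Measure.map_apply_of_aemeasurable hm (measurableSet_reachableSet _ _)] at h1
  rw [measureReal_def]
  refine (ENNReal.ofReal_le_iff_le_toReal (measure_ne_top _ _)).1 (h1.trans (measure_mono ?_))
  rintro ω ⟨y, hyS, hyc⟩
  have hemb : ∀ i, embed (A ω) 0 (fun j => y j) i = inner ℝ y (WithLp.toLp 2 (A ω i)) := by
    intro i
    simp [embed, Matrix.mulVec, dotProduct, PiLp.inner_apply]
  refine ⟨fun j => y j, ?_, fun i => ?_⟩
  · rw [hopt]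
    exact hdep _ fun i hi => (hemb i).trans (hyS i hi)
  · rw [hemb]
    by_cases hi : i ∈ S
    · rw [hyS i hi]
      exact hxbox i
    · exact abs_le.1 (hyc i hi)

/-! ### Normal tails and Beta integrals -/

lemma integrable_exp_neg_sq_div_two : Integrable fun x : ℝ => Real.exp (-x ^ 2 / 2) := by
  have h := integrable_exp_neg_mul_sq (b := 1 / 2) (by norm_num)
  refine h.congr (Eventually.of_forall fun x => ?_)
  beta_reduce
  congr 1
  ring

lemma one_sub_halfNormalCDF (t : ℝ) :
    1 - halfNormalCDF t = √(2 / Real.pi) * ∫ x in Set.Ioi t, Real.exp (-x ^ 2 / 2) := by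
  have h1 := integral_gaussian_Ioi (1 / 2)
  have h2 : √(2 / Real.pi) * ∫ x in Set.Ioi (0 : ℝ), Real.exp (-x ^ 2 / 2) = 1 := by
    have : ∀ x : ℝ, -x ^ 2 / 2 = -(1 / 2) * x ^ 2 := fun x => by ring
    simp_rw [this]
    rw [h1, ← mul_div_assoc, ← Real.sqrt_mul (by positivity)]
    have : 2 / Real.pi * (Real.pi / (1 / 2)) = 2 ^ 2 := by
      field_simp
    rw [this, Real.sqrt_sq (by norm_num)]
    norm_num
  have h3 := intervalIntegral.integral_interval_add_Ioi (a := 0) (b := t)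
    integrable_exp_neg_sq_div_two.integrableOn integrable_exp_neg_sq_div_two.integrableOn
  rw [← h2, ← h3, halfNormalCDF]
  ring

lemma sqrt_two_div_pi_le_one : √(2 / Real.pi) ≤ 1 :=
  Real.sqrt_le_one.2 ((div_le_one Real.pi_pos).2 Real.two_le_pi)

/-- The upper Mills bound for the normal tail. -/
lemma one_sub_halfNormalCDF_le {t : ℝ} (ht : 0 < t) :
    1 - halfNormalCDF t ≤ Real.exp (-t ^ 2 / 2) / t := by
  have hderiv : ∀ x ∈ Set.Ici t, HasDerivAt (fun x : ℝ => -(Real.exp (-x ^ 2 / 2) / t))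
      (x / t * Real.exp (-x ^ 2 / 2)) x := by
    intro x _
    have h := ((((hasDerivAt_id x).pow 2).neg.div_const 2).exp.div_const t).neg
    convert! h using 1
    simp only [id, Pi.pow_apply, Pi.neg_apply]
    field_simp
    ring
  have hlim : Tendsto (fun x : ℝ => -(Real.exp (-x ^ 2 / 2) / t)) atTop (nhds 0) := by
    have h1 : Tendsto (fun x : ℝ => -x ^ 2 / 2) atTop atBot := by
      have := (tendsto_pow_atTop (α := ℝ) two_ne_zero).const_mul_atTop_of_neg
        (r := -(1 / 2)) (by norm_num)
      refine this.congr fun x => by ring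
    simpa using ((Real.tendsto_exp_atBot.comp h1).div_const t).neg
  have hnn : ∀ x ∈ Set.Ioi t, 0 ≤ x / t * Real.exp (-x ^ 2 / 2) := fun x hx => by
    have : 0 < x := ht.trans hx
    positivity
  have hint := integrableOn_Ioi_deriv_of_nonneg' hderiv hnn hlim
  have hval := integral_Ioi_of_hasDerivAt_of_nonneg' hderiv hnn hlim
  rw [one_sub_halfNormalCDF]
  calc √(2 / Real.pi) * ∫ x in Set.Ioi t, Real.exp (-x ^ 2 / 2)
      ≤ 1 * ∫ x in Set.Ioi t, x / t * Real.exp (-x ^ 2 / 2) := by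
        refine mul_le_mul sqrt_two_div_pi_le_one ?_
          (integral_nonneg fun _ => (Real.exp_pos _).le) zero_le_one
        refine setIntegral_mono_on integrable_exp_neg_sq_div_two.integrableOn hint
          measurableSet_Ioi fun x hx => ?_
        have : 1 ≤ x / t := (one_le_div ht).2 (le_of_lt hx)
        exact le_mul_of_one_le_left (Real.exp_pos _).le this
    _ = Real.exp (-t ^ 2 / 2) / t := by
        rw [hval]
        ring

/-- A lower Mills bound for the normal tail. -/
lemma exp_neg_sq_le_one_sub_halfNormalCDF {t : ℝ} (ht : 0 ≤ t) :
    Real.exp (-t ^ 2 / 2) ≤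
      Real.exp (3 / 2) / √(2 / Real.pi) * ((1 + t) * (1 - halfNormalCDF t)) := by
  have hpi : 0 < √(2 / Real.pi) := Real.sqrt_pos.2 (div_pos two_pos Real.pi_pos)
  have h1t : 0 < 1 + t := by linarith
  -- the tail contains the mass of an interval of length `1 / (1 + t)`
  have h1 : (1 + t)⁻¹ * Real.exp (-t ^ 2 / 2 - 3 / 2) ≤
      ∫ x in Set.Ioi t, Real.exp (-x ^ 2 / 2) := by
    calc (1 + t)⁻¹ * Real.exp (-t ^ 2 / 2 - 3 / 2)
        = ∫ x in Set.Ioc t (t + (1 + t)⁻¹), Real.exp (-t ^ 2 / 2 - 3 / 2) := by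
          rw [setIntegral_const, measureReal_def, Real.volume_Ioc, add_sub_cancel_left,
            ENNReal.toReal_ofReal (by positivity), smul_eq_mul]
      _ ≤ ∫ x in Set.Ioc t (t + (1 + t)⁻¹), Real.exp (-x ^ 2 / 2) := by
          refine setIntegral_mono_on (integrableOn_const (by simp))
            integrable_exp_neg_sq_div_two.integrableOn measurableSet_Ioc fun x hx => ?_
          refine Real.exp_le_exp.2 ?_
          have hi : (1 + t)⁻¹ ≤ 1 := inv_le_one_of_one_le₀ (by linarith)
          have hi0 : 0 < (1 + t)⁻¹ := by positivity
          have hit : t * (1 + t)⁻¹ ≤ 1 := by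
            rw [← div_eq_mul_inv, div_le_one h1t]
            linarith
          have hx0 : 0 ≤ x := ht.trans hx.1.le
          have : x ^ 2 ≤ (t + (1 + t)⁻¹) ^ 2 := pow_le_pow_left₀ hx0 hx.2 2
          nlinarith
      _ ≤ _ := setIntegral_mono_set integrable_exp_neg_sq_div_two.integrableOn
          (Eventually.of_forall fun _ => (Real.exp_pos _).le)
          Set.Ioc_subset_Ioi_self.eventuallyLE
  rw [one_sub_halfNormalCDF]
  calc Real.exp (-t ^ 2 / 2)
      = Real.exp (3 / 2) * ((1 + t) * ((1 + t)⁻¹ * Real.exp (-t ^ 2 / 2 - 3 / 2))) := by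
        rw [mul_inv_cancel_left₀ h1t.ne', ← Real.exp_add]
        congr 1
        ring
    _ ≤ Real.exp (3 / 2) * ((1 + t) * ∫ x in Set.Ioi t, Real.exp (-x ^ 2 / 2)) := by
        gcongr
    _ = _ := by
        field_simp

/-- The integral `J` in the variable `t = s / Δ`, without its constants, for `Δ = √k`. -/
noncomputable def scaledJ (m n k : ℕ) : ℝ :=
  ∫ t in Set.Ioi (0 : ℝ), halfNormalCDF t ^ m * (t ^ (n - 1) * Real.exp (-(k * t ^ 2 / 2)))

lemma J_eq_scaledJ {n k : ℕ} (hn : 1 ≤ n) (hk : 1 ≤ k) (m : ℕ) :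
    J m n √k = 1 / (2 ^ ((n : ℝ) / 2 - 1) * Real.Gamma ((n : ℝ) / 2)) * √k ^ n *
      scaledJ m n k := by
  have hk0 : (0 : ℝ) < √k := Real.sqrt_pos.2 (by exact_mod_cast hk)
  have hsq : (√k : ℝ) ^ 2 = k := Real.sq_sqrt (Nat.cast_nonneg k)
  rw [J, mul_assoc]
  congr 1
  have h := integral_comp_mul_left_Ioi (fun t : ℝ => halfNormalCDF t ^ m *
    (t ^ (n - 1) * Real.exp (-(k * t ^ 2 / 2)))) 0 (inv_pos.2 hk0)
  rw [inv_inv, mul_zero, smul_eq_mul] at h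
  have hn' : √(k : ℝ) ^ n = √k ^ (n - 1) * √k := by
    rw [← pow_succ]
    congr 1
    omega
  rw [hn', mul_assoc, scaledJ, ← h, ← integral_const_mul]
  refine setIntegral_congr_fun measurableSet_Ioi fun s _ => ?_
  change halfNormalCDF (s / √k) ^ m * s ^ (n - 1) * Real.exp (-s ^ 2 / 2) = _
  have e1 : (k : ℝ) * ((√k)⁻¹ * s) ^ 2 / 2 = s ^ 2 / 2 := by
    rw [mul_pow, inv_pow, hsq]
    have : (k : ℝ) ≠ 0 := by positivity
    field_simp
  have e2 : √(k : ℝ) ^ (n - 1) * ((√k)⁻¹ * s) ^ (n - 1) = s ^ (n - 1) := by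
    rw [← mul_pow, mul_inv_cancel_left₀ hk0.ne']
  rw [e1, div_eq_inv_mul s, ← neg_div, ← e2]
  ring

lemma integrableOn_pow_mul_exp_neg {a : ℝ} (ha : 0 < a) (j : ℕ) :
    IntegrableOn (fun t : ℝ => t ^ j * Real.exp (-(a * t ^ 2 / 2))) (Set.Ioi 0) := by
  have h := (integrable_rpow_mul_exp_neg_mul_sq (b := a / 2) (by positivity) (s := j)
    (by linarith [(Nat.cast_nonneg j : (0 : ℝ) ≤ j)])).integrableOn (s := Set.Ioi 0)
  refine h.congr_fun (fun t _ => ?_) measurableSet_Ioi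
  beta_reduce
  rw [Real.rpow_natCast]
  congr 2
  ring

lemma integrableOn_scaledJ {k : ℕ} (hk : 1 ≤ k) (m n : ℕ) :
    IntegrableOn (fun t : ℝ => halfNormalCDF t ^ m *
      (t ^ (n - 1) * Real.exp (-(k * t ^ 2 / 2)))) (Set.Ioi 0) := by
  refine (integrableOn_pow_mul_exp_neg (a := k) (by exact_mod_cast hk) (n - 1)).bdd_mul (c := 1)
    (by fun_prop) ?_
  filter_upwards [ae_restrict_mem measurableSet_Ioi] with t ht
  have h0 := halfNormalCDF_nonneg (le_of_lt ht)
  rw [Real.norm_eq_abs, abs_of_nonneg (by positivity)]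
  exact pow_le_one₀ h0 (halfNormalCDF_le_one _)

/-- The Beta integral `B(m + 1, k)` is of order `(m + 1) ^ (-k)` for fixed `k`. -/
lemma integral_pow_mul_one_sub_pow_le (m : ℕ) {k : ℕ} (hk : 1 ≤ k) :
    ∫ u in (0 : ℝ)..1, u ^ m * (1 - u) ^ (k - 1) ≤
      Real.exp 1 * Real.Gamma k / ((m : ℝ) + 1) ^ k := by
  have hN : (0 : ℝ) < (m : ℝ) + 1 := by positivity
  have hg := Real.integral_rpow_mul_exp_neg_mul_Ioi (a := k) (by exact_mod_cast hk) hN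
  have hi : IntegrableOn (fun v : ℝ => v ^ (k - 1) * Real.exp (-(((m : ℝ) + 1) * v)))
      (Set.Ioi 0) := by
    -- the value of the integral is non-zero
    by_contra hcon
    have e : ∫ t in Set.Ioi (0 : ℝ), t ^ ((k : ℝ) - 1) * Real.exp (-(((m : ℝ) + 1) * t)) =
        ∫ v in Set.Ioi (0 : ℝ), v ^ (k - 1) * Real.exp (-(((m : ℝ) + 1) * v)) := by
      refine setIntegral_congr_fun measurableSet_Ioi fun t _ => ?_
      rw [← Real.rpow_natCast, Nat.cast_sub hk, Nat.cast_one]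
    rw [e, integral_undef hcon] at hg
    have : 0 < Real.Gamma k := Real.Gamma_pos_of_pos (by exact_mod_cast hk)
    have : 0 < (1 / ((m : ℝ) + 1)) ^ (k : ℝ) * Real.Gamma k := by positivity
    linarith
  have h1 : ∫ u in (0 : ℝ)..1, u ^ m * (1 - u) ^ (k - 1) =
      ∫ v in (0 : ℝ)..1, (1 - v) ^ m * v ^ (k - 1) := by
    have := intervalIntegral.integral_comp_sub_left (a := 0) (b := 1)
      (fun v : ℝ => (1 - v) ^ m * v ^ (k - 1)) 1
    simpa using this
  rw [h1, intervalIntegral.integral_of_le zero_le_one]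
  calc ∫ v in Set.Ioc (0 : ℝ) 1, (1 - v) ^ m * v ^ (k - 1)
      ≤ ∫ v in Set.Ioc (0 : ℝ) 1,
          Real.exp 1 * (v ^ (k - 1) * Real.exp (-(((m : ℝ) + 1) * v))) := by
        refine setIntegral_mono_on ?_ ((hi.mono_set Set.Ioc_subset_Ioi_self).const_mul _)
          measurableSet_Ioc fun v hv => ?_
        · exact ((by fun_prop : Continuous fun v : ℝ => (1 - v) ^ m * v ^ (k - 1)).integrableOn_Icc
            (a := 0) (b := 1)).mono_set Set.Ioc_subset_Icc_self
        · have hv1 : (1 - v) ^ m ≤ Real.exp 1 * Real.exp (-(((m : ℝ) + 1) * v)) := by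
            calc (1 - v) ^ m ≤ Real.exp (-v) ^ m :=
                  pow_le_pow_left₀ (by linarith [hv.2]) (Real.one_sub_le_exp_neg v) m
              _ = Real.exp (-(m * v)) := by
                  rw [← Real.exp_nat_mul]
                  congr 1
                  ring
              _ ≤ Real.exp (1 + -(((m : ℝ) + 1) * v)) :=
                  Real.exp_le_exp.2 (by linarith [hv.2])
              _ = _ := Real.exp_add _ _
          calc (1 - v) ^ m * v ^ (k - 1)
              ≤ Real.exp 1 * Real.exp (-(((m : ℝ) + 1) * v)) * v ^ (k - 1) :=
                mul_le_mul_of_nonneg_right hv1 (pow_nonneg hv.1.le _)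
            _ = _ := by ring
    _ ≤ ∫ v in Set.Ioi (0 : ℝ),
          Real.exp 1 * (v ^ (k - 1) * Real.exp (-(((m : ℝ) + 1) * v))) := by
        refine setIntegral_mono_set (hi.const_mul _) ?_ Set.Ioc_subset_Ioi_self.eventuallyLE
        filter_upwards [ae_restrict_mem measurableSet_Ioi] with v hv
        have : (0 : ℝ) < v := hv
        simp only [Pi.zero_apply]
        positivity
    _ = Real.exp 1 * ((1 / ((m : ℝ) + 1)) ^ (k : ℝ) * Real.Gamma k) := by
        rw [integral_const_mul, ← hg]
        congr 1
        refine setIntegral_congr_fun measurableSet_Ioi fun t _ => ?_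
        rw [← Real.rpow_natCast, Nat.cast_sub hk, Nat.cast_one]
    _ = _ := by
        rw [Real.rpow_natCast, one_div, inv_pow]
        field_simp

/-! ### Asymptotics of the integral -/

lemma sqrt_pow_eq_rpow {L : ℝ} (hL : 0 ≤ L) (j : ℕ) : √L ^ j = L ^ ((j : ℝ) / 2) := by
  rw [Real.sqrt_eq_rpow, ← Real.rpow_natCast, ← Real.rpow_mul hL]
  congr 1
  ring

/-- The upper estimate. Up to `t = 2 √(log (m + 1))` the Mills bound turns the integrand into a
Beta integral in the variable `halfNormalCDF t`; beyond that point half of the Gaussian weight is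
already of order `(m + 1) ^ (-k)`. -/
lemma scaledJ_le {n k : ℕ} (hn : 1 ≤ n) (hk : 1 ≤ k) :
    ∃ C : ℝ, ∀ m : ℕ, 1 ≤ Real.log ((m : ℝ) + 1) →
      scaledJ m n k ≤ C * (√(Real.log ((m : ℝ) + 1)) ^ (n + k - 2) / ((m : ℝ) + 1) ^ k) := by
  have hk0 : (0 : ℝ) < k := by exact_mod_cast hk
  have hpi : 0 < √(2 / Real.pi) := Real.sqrt_pos.2 (div_pos two_pos Real.pi_pos)
  set B := Real.exp (3 / 2) / √(2 / Real.pi) with hB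
  have hB0 : 0 < B := by positivity
  set C₁ := ∫ t in Set.Ioi (0 : ℝ), t ^ (n - 1) * Real.exp (-(((k : ℝ) / 2) * t ^ 2 / 2)) with hC₁
  have hC₁0 : 0 ≤ C₁ := setIntegral_nonneg measurableSet_Ioi fun t ht => by
    have : (0 : ℝ) < t := ht
    positivity
  refine ⟨B ^ (k - 1) / √(2 / Real.pi) * 4 ^ (n + k - 2) * (Real.exp 1 * Real.Gamma k) + C₁,
    fun m hL => ?_⟩
  set L := Real.log ((m : ℝ) + 1) with hLdef
  have hN : (0 : ℝ) < (m : ℝ) + 1 := by positivity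
  have hs1 : 1 ≤ √L := Real.one_le_sqrt.2 hL
  have hsq : √L ^ 2 = L := Real.sq_sqrt (by linarith)
  set T := 2 * √L with hT
  have hT0 : 0 ≤ T := by positivity
  have hint := integrableOn_scaledJ hk m n
  have hH : ∀ t : ℝ, 0 ≤ t → 0 ≤ halfNormalCDF t := fun t => halfNormalCDF_nonneg
  have hQ : ∀ t : ℝ, 0 ≤ 1 - halfNormalCDF t := fun t => sub_nonneg.2 (halfNormalCDF_le_one t)
  have hint2 : IntegrableOn (fun t : ℝ => t ^ (n - 1) * Real.exp (-(((k : ℝ) / 2) * t ^ 2 / 2)))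
      (Set.Ioi 0) := integrableOn_pow_mul_exp_neg (by positivity) _
  -- the far part
  have hfar : ∫ t in Set.Ioi T, halfNormalCDF t ^ m *
      (t ^ (n - 1) * Real.exp (-(k * t ^ 2 / 2))) ≤ C₁ * (1 / ((m : ℝ) + 1) ^ k) := by
    have hsub : Set.Ioi T ⊆ Set.Ioi 0 := Set.Ioi_subset_Ioi hT0
    calc ∫ t in Set.Ioi T, halfNormalCDF t ^ m * (t ^ (n - 1) * Real.exp (-(k * t ^ 2 / 2)))
        ≤ ∫ t in Set.Ioi T, t ^ (n - 1) * Real.exp (-(((k : ℝ) / 2) * t ^ 2 / 2)) *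
            (1 / ((m : ℝ) + 1) ^ k) := by
          refine setIntegral_mono_on (hint.mono_set hsub)
            ((hint2.mono_set hsub).mul_const _) measurableSet_Ioi fun t ht => ?_
          have htT : T < t := ht
          have ht0 : 0 ≤ t := hT0.trans htT.le
          have hexp : Real.exp (-(k * t ^ 2 / 2)) ≤
              Real.exp (-(((k : ℝ) / 2) * t ^ 2 / 2)) * (1 / ((m : ℝ) + 1) ^ k) := by
            have e : 1 / ((m : ℝ) + 1) ^ k = Real.exp (-(k * L)) := by
              rw [Real.exp_neg, Real.exp_nat_mul, hLdef, Real.exp_log hN, one_div]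
            rw [e, ← Real.exp_add]
            refine Real.exp_le_exp.2 ?_
            have : T ^ 2 ≤ t ^ 2 := pow_le_pow_left₀ hT0 htT.le 2
            have : 4 * L ≤ t ^ 2 := by nlinarith
            nlinarith
          calc halfNormalCDF t ^ m * (t ^ (n - 1) * Real.exp (-(k * t ^ 2 / 2)))
              ≤ 1 * (t ^ (n - 1) * Real.exp (-(k * t ^ 2 / 2))) :=
                mul_le_mul_of_nonneg_right (pow_le_one₀ (hH t ht0) (halfNormalCDF_le_one t))
                  (by positivity)
            _ ≤ t ^ (n - 1) * (Real.exp (-(((k : ℝ) / 2) * t ^ 2 / 2)) *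
                (1 / ((m : ℝ) + 1) ^ k)) := by
                rw [one_mul]
                gcongr
            _ = _ := by ring
      _ = (∫ t in Set.Ioi T, t ^ (n - 1) * Real.exp (-(((k : ℝ) / 2) * t ^ 2 / 2))) *
            (1 / ((m : ℝ) + 1) ^ k) := integral_mul_const _ _
      _ ≤ _ := by
          refine mul_le_mul_of_nonneg_right (setIntegral_mono_set hint2 ?_ hsub.eventuallyLE)
            (by positivity)
          filter_upwards [ae_restrict_mem measurableSet_Ioi] with t ht
          have : (0 : ℝ) < t := ht
          simp only [Pi.zero_apply]
          positivity
  -- the near part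
  set g : ℝ → ℝ := fun u => u ^ m * (1 - u) ^ (k - 1) with hg
  have hgc : Continuous g := by fun_prop
  have hnear : ∫ t in Set.Ioc 0 T, halfNormalCDF t ^ m *
      (t ^ (n - 1) * Real.exp (-(k * t ^ 2 / 2))) ≤
      B ^ (k - 1) / √(2 / Real.pi) * 4 ^ (n + k - 2) * √L ^ (n + k - 2) *
        (Real.exp 1 * Real.Gamma k / ((m : ℝ) + 1) ^ k) := by
    set K := B ^ (k - 1) / √(2 / Real.pi) * (4 * √L) ^ (n + k - 2) with hK
    have hK0 : 0 ≤ K := by positivity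
    calc ∫ t in Set.Ioc 0 T, halfNormalCDF t ^ m * (t ^ (n - 1) * Real.exp (-(k * t ^ 2 / 2)))
        ≤ ∫ t in Set.Ioc 0 T, K * (g (halfNormalCDF t) *
            (√(2 / Real.pi) * Real.exp (-t ^ 2 / 2))) := by
          refine setIntegral_mono_on (hint.mono_set Set.Ioc_subset_Ioi_self) ?_
            measurableSet_Ioc fun t ht => ?_
          · exact ((by fun_prop : Continuous fun t : ℝ => K * (g (halfNormalCDF t) *
              (√(2 / Real.pi) * Real.exp (-t ^ 2 / 2)))).integrableOn_Icc
              (a := 0) (b := T)).mono_set Set.Ioc_subset_Icc_self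
          · have ht0 : 0 ≤ t := ht.1.le
            have hexp : Real.exp (-(k * t ^ 2 / 2)) =
                Real.exp (-t ^ 2 / 2) ^ (k - 1) * Real.exp (-t ^ 2 / 2) := by
              rw [← pow_succ, Nat.sub_add_cancel hk, ← Real.exp_nat_mul]
              congr 1
              ring
            have hmills := pow_le_pow_left₀ (Real.exp_pos _).le
              (exp_neg_sq_le_one_sub_halfNormalCDF ht0) (k - 1)
            have h4 : 1 + t ≤ 4 * √L := by linarith [ht.2]
            have hpow : t ^ (n - 1) * (1 + t) ^ (k - 1) ≤ (4 * √L) ^ (n + k - 2) := by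
              calc t ^ (n - 1) * (1 + t) ^ (k - 1)
                  ≤ (4 * √L) ^ (n - 1) * (4 * √L) ^ (k - 1) := by
                    gcongr
                    linarith
                _ = _ := by
                    rw [← pow_add]
                    congr 1
                    omega
            have hHt := hH t ht0
            have hQt := hQ t
            rw [hexp]
            calc halfNormalCDF t ^ m * (t ^ (n - 1) *
                  (Real.exp (-t ^ 2 / 2) ^ (k - 1) * Real.exp (-t ^ 2 / 2)))
                ≤ halfNormalCDF t ^ m * (t ^ (n - 1) *
                  ((B * ((1 + t) * (1 - halfNormalCDF t))) ^ (k - 1) *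
                    Real.exp (-t ^ 2 / 2))) := by gcongr
              _ = B ^ (k - 1) * (t ^ (n - 1) * (1 + t) ^ (k - 1)) *
                  (g (halfNormalCDF t) * Real.exp (-t ^ 2 / 2)) := by
                  rw [mul_pow, mul_pow, hg]
                  ring
              _ ≤ B ^ (k - 1) * (4 * √L) ^ (n + k - 2) *
                  (g (halfNormalCDF t) * Real.exp (-t ^ 2 / 2)) := by
                  have : 0 ≤ g (halfNormalCDF t) := by positivity
                  gcongr
              _ = _ := by
                  rw [hK]
                  field_simp
      _ = K * ∫ u in (0 : ℝ)..halfNormalCDF T, g u := by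
          rw [integral_const_mul, ← intervalIntegral.integral_of_le hT0]
          have h := intervalIntegral.integral_comp_mul_deriv (a := 0) (b := T) (g := g)
            (fun t _ => hasDerivAt_halfNormalCDF t) (by fun_prop) hgc
          rw [halfNormalCDF_zero] at h
          rw [← h]
          rfl
      _ ≤ K * ∫ u in (0 : ℝ)..1, g u := by
          refine mul_le_mul_of_nonneg_left ?_ hK0
          refine intervalIntegral.integral_mono_interval le_rfl (hH T hT0)
            (halfNormalCDF_le_one T) ?_ (hgc.intervalIntegrable _ _)
          filter_upwards [ae_restrict_mem measurableSet_Ioc] with u hu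
          have h0 : 0 ≤ u := hu.1.le
          have h1 : 0 ≤ 1 - u := sub_nonneg.2 hu.2
          simp only [Pi.zero_apply, hg]
          positivity
      _ ≤ K * (Real.exp 1 * Real.Gamma k / ((m : ℝ) + 1) ^ k) :=
          mul_le_mul_of_nonneg_left (integral_pow_mul_one_sub_pow_le m hk) hK0
      _ = _ := by
          rw [hK, mul_pow]
          ring
  rw [scaledJ, ← Set.Ioc_union_Ioi_eq_Ioi hT0, setIntegral_union (Set.Ioc_disjoint_Ioi le_rfl)
    measurableSet_Ioi (hint.mono_set Set.Ioc_subset_Ioi_self)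
    (hint.mono_set (Set.Ioi_subset_Ioi hT0))]
  have hone : 1 ≤ √L ^ (n + k - 2) := one_le_pow₀ hs1
  calc _ ≤ _ := add_le_add hnear hfar
    _ ≤ B ^ (k - 1) / √(2 / Real.pi) * 4 ^ (n + k - 2) * √L ^ (n + k - 2) *
        (Real.exp 1 * Real.Gamma k / ((m : ℝ) + 1) ^ k) +
        C₁ * (√L ^ (n + k - 2) / ((m : ℝ) + 1) ^ k) := by gcongr
    _ = _ := by ring

/-- The lower estimate: just beyond the point `T` with `exp (-T² / 2) = √(log (m + 1)) / (m + 1)`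
the factor `halfNormalCDF t ^ m` is bounded below, and an interval of length `1 / T` there carries
enough of the Gaussian weight. -/
lemma le_scaledJ {n k : ℕ} (hn : 1 ≤ n) (hk : 1 ≤ k) :
    ∃ c : ℝ, 0 < c ∧ ∀ m : ℕ, 1 ≤ Real.log ((m : ℝ) + 1) →
      c * (√(Real.log ((m : ℝ) + 1)) ^ (n + k - 2) / ((m : ℝ) + 1) ^ k) ≤ scaledJ m n k := by
  have hk0 : (0 : ℝ) < k := by exact_mod_cast hk
  refine ⟨Real.exp (-1) * Real.exp (-(3 * k / 2)) / √2, by positivity, fun m hL => ?_⟩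
  set L := Real.log ((m : ℝ) + 1) with hLdef
  have hN : (0 : ℝ) < (m : ℝ) + 1 := by positivity
  have hL0 : 0 < L := by linarith
  have hs1 : 1 ≤ √L := Real.one_le_sqrt.2 hL
  have hs0 : 0 < √L := by linarith
  have hm : (0 : ℝ) < m := by
    rcases Nat.eq_zero_or_pos m with rfl | h
    · norm_num [hLdef] at hL
    · exact_mod_cast h
  set T := √(2 * L - Real.log L) with hT
  have hlog0 : 0 ≤ Real.log L := Real.log_nonneg hL
  have hlogL : Real.log L ≤ L := (Real.log_le_sub_one_of_pos hL0).trans (by linarith)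
  have hTsq : T ^ 2 = 2 * L - Real.log L := Real.sq_sqrt (by linarith)
  have hTL : √L ≤ T := Real.sqrt_le_sqrt (by linarith)
  have hTL2 : T ≤ √2 * √L := by
    rw [← Real.sqrt_mul (by norm_num)]
    exact Real.sqrt_le_sqrt (by linarith)
  have hT1 : 1 ≤ T := hs1.trans hTL
  have hT0 : 0 < T := by linarith
  have hexpT : Real.exp (-T ^ 2 / 2) = √L / ((m : ℝ) + 1) := by
    have : -T ^ 2 / 2 = Real.log (√L) - L := by
      rw [hTsq, Real.log_sqrt hL0.le]
      ring
    rw [this, Real.exp_sub, Real.exp_log hs0, hLdef, Real.exp_log hN]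
  -- a lower bound for the integrand on an interval of length `1 / T`
  have hH : ∀ t, T ≤ t → Real.exp (-1) ≤ halfNormalCDF t ^ m := by
    intro t ht
    have ht0 : 0 < t := hT0.trans_le ht
    have h1 : 1 - halfNormalCDF t ≤ 1 / ((m : ℝ) + 1) := by
      calc 1 - halfNormalCDF t ≤ 1 - halfNormalCDF T :=
            sub_le_sub_left (strictMono_halfNormalCDF.monotone ht) 1
        _ ≤ Real.exp (-T ^ 2 / 2) / T := one_sub_halfNormalCDF_le hT0
        _ ≤ √L / ((m : ℝ) + 1) / √L := by
            rw [hexpT]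
            gcongr
        _ = 1 / ((m : ℝ) + 1) := by field_simp
    have h2 : Real.exp (-(1 / m)) ≤ halfNormalCDF t := by
      have h3 : (m : ℝ) / (m + 1) ≤ halfNormalCDF t := by
        have : (m : ℝ) / (m + 1) = 1 - 1 / ((m : ℝ) + 1) := by
          field_simp
          ring
        linarith
      refine le_trans ?_ h3
      rw [Real.exp_neg, ← inv_div ((m : ℝ) + 1)]
      refine inv_anti₀ (div_pos hN hm) ?_
      calc ((m : ℝ) + 1) / m = 1 / m + 1 := by rw [add_div, div_self hm.ne', add_comm]
        _ ≤ Real.exp (1 / m) := Real.add_one_le_exp _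
    calc Real.exp (-1) = Real.exp (-(1 / m)) ^ m := by
          rw [← Real.exp_nat_mul]
          congr 1
          field_simp
      _ ≤ _ := pow_le_pow_left₀ (Real.exp_pos _).le h2 m
  have hint := integrableOn_scaledJ hk m n
  have hsub : Set.Ioc T (T + 1 / T) ⊆ Set.Ioi 0 := fun t ht => hT0.trans ht.1
  have hexpk : Real.exp (-(k * (T ^ 2 + 3) / 2)) =
      Real.exp (-(3 * k / 2)) * (√L / ((m : ℝ) + 1)) ^ k := by
    rw [← hexpT, ← Real.exp_nat_mul, ← Real.exp_add]
    congr 1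
    ring
  calc Real.exp (-1) * Real.exp (-(3 * k / 2)) / √2 *
        (√L ^ (n + k - 2) / ((m : ℝ) + 1) ^ k)
      = Real.exp (-1) * (√L ^ (n - 1) * Real.exp (-(k * (T ^ 2 + 3) / 2))) *
          (1 / (√2 * √L)) := by
        have e : √L ^ (n + k - 2) * √L = √L ^ (n - 1) * √L ^ k := by
          rw [← pow_succ, ← pow_add]
          congr 1
          omega
        rw [hexpk, div_pow]
        field_simp
        linear_combination e
    _ ≤ Real.exp (-1) * (T ^ (n - 1) * Real.exp (-(k * (T ^ 2 + 3) / 2))) * (1 / T) := by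
        gcongr
    _ = ∫ t in Set.Ioc T (T + 1 / T),
          Real.exp (-1) * (T ^ (n - 1) * Real.exp (-(k * (T ^ 2 + 3) / 2))) := by
        rw [setIntegral_const, measureReal_def, Real.volume_Ioc, add_sub_cancel_left,
          ENNReal.toReal_ofReal (by positivity), smul_eq_mul, mul_comm]
    _ ≤ ∫ t in Set.Ioc T (T + 1 / T),
          halfNormalCDF t ^ m * (t ^ (n - 1) * Real.exp (-(k * t ^ 2 / 2))) := by
        refine setIntegral_mono_on (integrableOn_const (by simp)) (hint.mono_set hsub)
          measurableSet_Ioc fun t ht => ?_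
        have ht0 : 0 < t := hT0.trans ht.1
        have hsq : t ^ 2 ≤ T ^ 2 + 3 := by
          have h1 : t ^ 2 ≤ (T + 1 / T) ^ 2 := pow_le_pow_left₀ ht0.le ht.2 2
          have h2 : (T + 1 / T) ^ 2 = T ^ 2 + 2 + (1 / T) ^ 2 := by
            field_simp
            ring
          have h3 : (1 / T) ^ 2 ≤ 1 :=
            pow_le_one₀ (by positivity) ((div_le_one hT0).2 hT1)
          linarith
        have htT := ht.1.le
        have hHt := hH t htT
        have hHt0 : 0 ≤ halfNormalCDF t ^ m := (Real.exp_pos _).le.trans hHt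
        gcongr
    _ ≤ _ := by
        refine setIntegral_mono_set hint ?_ hsub.eventuallyLE
        filter_upwards [ae_restrict_mem measurableSet_Ioi] with t ht
        have h0 := halfNormalCDF_nonneg (le_of_lt ht)
        have : (0 : ℝ) < t := ht
        simp only [Pi.zero_apply]
        positivity

lemma scaledJ_pos {n k : ℕ} (hk : 1 ≤ k) (m : ℕ) : 0 < scaledJ m n k := by
  have hpos : ∀ t ∈ Set.Ioi (0 : ℝ),
      0 < halfNormalCDF t ^ m * (t ^ (n - 1) * Real.exp (-(k * t ^ 2 / 2))) := fun t ht => by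
    have h0 : 0 < halfNormalCDF t := halfNormalCDF_zero ▸ strictMono_halfNormalCDF ht
    have : (0 : ℝ) < t := ht
    positivity
  rw [scaledJ, setIntegral_pos_iff_support_of_nonneg_ae ?_ (integrableOn_scaledJ hk m n)]
  · refine lt_of_lt_of_le ?_ (measure_mono (μ := volume) (s := Set.Ioi 0)
      fun t ht => ⟨(hpos t ht).ne', ht⟩)
    simp
  · filter_upwards [ae_restrict_mem measurableSet_Ioi] with t ht
    exact (hpos t ht).le

lemma J_const_pos {n k : ℕ} (hn : 1 ≤ n) (hk : 1 ≤ k) :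
    0 < 1 / (2 ^ ((n : ℝ) / 2 - 1) * Real.Gamma ((n : ℝ) / 2)) * √(k : ℝ) ^ n := by
  have hn0 : (0 : ℝ) < n := by exact_mod_cast hn
  have : 0 < Real.Gamma ((n : ℝ) / 2) := Real.Gamma_pos_of_pos (by positivity)
  have : (0 : ℝ) < √k := Real.sqrt_pos.2 (by exact_mod_cast hk)
  positivity

lemma tau_pos {D d de : ℕ} (hde : 1 ≤ de) : 0 < tau D d de := by
  rw [tau, J_eq_scaledJ (by omega) hde]
  exact mul_pos (J_const_pos (by omega) hde) (scaledJ_pos hde _)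

lemma exists_tau_bounds {d de : ℕ} (hde : 1 ≤ de) (hd : de ≤ d) :
    ∃ M₁ M₂ : ℝ, 0 < M₁ ∧ ∀ᶠ D : ℕ in atTop, 1 ≤ Real.log ((D : ℝ) - de + 1) ∧ de < D ∧
      M₁ * (Real.log ((D : ℝ) - de + 1) ^ (((d : ℝ) - 1) / 2) / ((D : ℝ) - de + 1) ^ de) ≤
        tau D d de ∧
      tau D d de ≤
        M₂ * (Real.log ((D : ℝ) - de + 1) ^ (((d : ℝ) - 1) / 2) / ((D : ℝ) - de + 1) ^ de) := by
  have hn : 1 ≤ d - de + 1 := by omega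
  obtain ⟨C, hC⟩ := scaledJ_le hn hde
  obtain ⟨c, hc0, hc⟩ := le_scaledJ hn hde
  have hK := J_const_pos hn hde
  set K := 1 / (2 ^ (((d - de + 1 : ℕ) : ℝ) / 2 - 1) * Real.Gamma (((d - de + 1 : ℕ) : ℝ) / 2)) *
    √(de : ℝ) ^ (d - de + 1) with hKdef
  refine ⟨K * c, K * C, mul_pos hK hc0, ?_⟩
  have hlog : Tendsto (fun D : ℕ => Real.log ((D : ℝ) - de + 1)) atTop atTop := by
    refine Real.tendsto_log_atTop.comp (tendsto_atTop_add_const_right _ _ ?_)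
    exact tendsto_atTop_add_const_right _ (-(de : ℝ)) tendsto_natCast_atTop_atTop
  filter_upwards [hlog.eventually_ge_atTop 1, eventually_gt_atTop de] with D hL hD
  have hcast : ((D - de : ℕ) : ℝ) + 1 = (D : ℝ) - de + 1 := by
    rw [Nat.cast_sub hD.le]
  have hexp : √(Real.log ((D : ℝ) - de + 1)) ^ (d - de + 1 + de - 2) =
      Real.log ((D : ℝ) - de + 1) ^ (((d : ℝ) - 1) / 2) := by
    rw [sqrt_pow_eq_rpow (by linarith)]
    congr 2
    have : d - de + 1 + de - 2 = d - 1 := by omega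
    rw [this, Nat.cast_sub (by omega), Nat.cast_one]
  have h1 := hC (D - de)
  have h2 := hc (D - de)
  rw [hcast, hexp] at h1 h2
  refine ⟨hL, hD, ?_, ?_⟩
  · rw [tau, J_eq_scaledJ hn hde, mul_assoc]
    exact mul_le_mul_of_nonneg_left (h2 hL) hK.le
  · rw [tau, J_eq_scaledJ hn hde, mul_assoc K]
    exact mul_le_mul_of_nonneg_left (h1 hL) hK.le

lemma tau_isTheta {d de : ℕ} (hde : 1 ≤ de) (hd : de ≤ d) :
    (fun D : ℕ => tau D d de) =Θ[atTop]
      fun D : ℕ => Real.log ((D : ℝ) - de + 1) ^ (((d : ℝ) - 1) / 2) /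
        ((D : ℝ) - de + 1) ^ de := by
  obtain ⟨M₁, M₂, hM₁, h⟩ := exists_tau_bounds hde hd
  have hpos : ∀ D : ℕ, 1 ≤ Real.log ((D : ℝ) - de + 1) → de < D →
      0 ≤ Real.log ((D : ℝ) - de + 1) ^ (((d : ℝ) - 1) / 2) / ((D : ℝ) - de + 1) ^ de := by
    intro D hL hD
    have : (de : ℝ) < D := by exact_mod_cast hD
    exact div_nonneg (Real.rpow_nonneg (by linarith) _) (pow_nonneg (by linarith) _)
  refine ⟨IsBigO.of_bound M₂ ?_, IsBigO.of_bound M₁⁻¹ ?_⟩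
  · filter_upwards [h] with D hD
    rw [Real.norm_of_nonneg (tau_pos hde).le, Real.norm_of_nonneg (hpos D hD.1 hD.2.1)]
    exact hD.2.2.2
  · filter_upwards [h] with D hD
    rw [Real.norm_of_nonneg (tau_pos hde).le, Real.norm_of_nonneg (hpos D hD.1 hD.2.1)]
    exact (le_inv_mul_iff₀ hM₁).2 hD.2.2.1

/-- The logarithmic factor only helps, and the finitely many small `D` are absorbed in the
constant. -/
lemma exists_div_pow_le_tau {d de : ℕ} (hde : 1 ≤ de) (hd : de ≤ d) :
    ∃ c : ℝ, 0 < c ∧ ∀ D : ℕ, de < D → c / (D : ℝ) ^ de ≤ tau D d de := by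
  obtain ⟨M₁, M₂, hM₁, h⟩ := exists_tau_bounds hde hd
  obtain ⟨D₀, hD₀⟩ := eventually_atTop.1 h
  obtain ⟨c, hc0, hc⟩ : ∃ c : ℝ, 0 < c ∧ ∀ D ∈ Finset.range D₀, c ≤ tau D d de := by
    rcases (Finset.range D₀).eq_empty_or_nonempty with he | hne
    · exact ⟨1, one_pos, by simp [he]⟩
    · obtain ⟨D, -, hD⟩ := Finset.exists_min_image _ (fun D => tau D d de) hne
      exact ⟨tau D d de, tau_pos hde, hD⟩
  refine ⟨min c M₁, lt_min hc0 hM₁, fun D hD => ?_⟩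
  have hD1 : (1 : ℝ) ≤ D := by exact_mod_cast (by omega : 1 ≤ D)
  rcases lt_or_ge D D₀ with hlt | hge
  · calc min c M₁ / (D : ℝ) ^ de ≤ min c M₁ :=
          div_le_self (lt_min hc0 hM₁).le (one_le_pow₀ hD1)
      _ ≤ _ := (min_le_left _ _).trans (hc D (Finset.mem_range.2 hlt))
  · obtain ⟨hL, -, hlow, -⟩ := hD₀ D hge
    refine le_trans ?_ hlow
    have hDde : (de : ℝ) < D := by exact_mod_cast hD
    have hde1 : (1 : ℝ) ≤ de := by exact_mod_cast hde
    have hd1 : (1 : ℝ) ≤ d := by exact_mod_cast hde.trans hd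
    have hpow : 1 ≤ Real.log ((D : ℝ) - de + 1) ^ (((d : ℝ) - 1) / 2) :=
      Real.one_le_rpow hL (by linarith)
    have hb0 : (0 : ℝ) < (D : ℝ) - de + 1 := by linarith
    calc min c M₁ / (D : ℝ) ^ de = min c M₁ * (1 / (D : ℝ) ^ de) := by ring
      _ ≤ M₁ * (Real.log ((D : ℝ) - de + 1) ^ (((d : ℝ) - 1) / 2) /
          ((D : ℝ) - de + 1) ^ de) := by
          refine mul_le_mul (min_le_right _ _) ?_ (by positivity) hM₁.le
          refine div_le_div₀ (by linarith) hpow (by positivity) ?_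
          exact pow_le_pow_left₀ hb0.le (by linarith) _

end XREGO

theorem theorem3p9 (de d : ℕ) (hde : 1 ≤ de) (hd : de ≤ d) :
    ((fun D : ℕ => XREGO.tau D d de) =Θ[atTop]
      fun D : ℕ => Real.log ((D : ℝ) - de + 1) ^ (((d : ℝ) - 1) / 2) /
        ((D : ℝ) - de + 1) ^ de) ∧
    ∃ c : ℝ, 0 < c ∧
      ∀ D : ℕ, de < D →
      ∀ f : EuclideanSpace ℝ (Fin D) → ℝ, Continuous f →
      ∀ T : Submodule ℝ (EuclideanSpace ℝ (Fin D)),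
        XREGO.IsEffectiveSubspace f de T → XREGO.IsCoordinateAligned T →
      ∀ (Ω : Type*) [MeasurableSpace Ω] (P : Measure Ω) [IsProbabilityMeasure P]
        (A : Ω → Matrix (Fin D) (Fin d) ℝ), XREGO.IsGaussianMatrix A P →
        0 < XREGO.tau D d de ∧
        XREGO.tau D d de ≤ P.real {ω | XREGO.Successful f (A ω) 0} ∧
        c / (D : ℝ) ^ de ≤ P.real {ω | XREGO.Successful f (A ω) 0} := by
  refine ⟨XREGO.tau_isTheta hde hd, ?_⟩
  obtain ⟨c, hc0, hc⟩ := XREGO.exists_div_pow_le_tau hde hd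
  refine ⟨c, hc0, fun D hD f hf T hT hTc Ω _ P _ A hA => ?_⟩
  have h := hA.tau_le_prob_successful hde hd hD hf hT hTc
  exact ⟨XREGO.tau_pos hde, h, (hc D hD).trans h⟩
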